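/- Theorem. Let $(\Lambda,\Gamma^{(1)},\Gamma^{(2)})$ be a two edge type degree distribution: $\Lambda=(\Lambda_{l_1,l_2})$ is a finitely supported probability distribution on pairs of natural numbers ($\Lambda_{l_1,l_2}$ is the fraction of variable nodes with $l_1$ edges of type one and $l_2$ edges of type two), and, for $j=1,2$, $\Gamma^{(j)}=(\Gamma^{(j)}_r)$ is a finitely supported probability distribution on natural numbers (the fraction of type $j$ check nodes of degree $r$). Put $\Lambda_j'=\sum_{l_1,l_2} l_j\Lambda_{l_1,l_2}$, $\Gamma'^{(j)}=\sum_r r\,\Gamma^{(j)}_r$, and $R_{\mathrm{des}}=1-\Lambda_1'/\Gamma'^{(1)}-\Lambda_2'/\Gamma'^{(2)}$. Assume for $j=1,2$ that $\Lambda_j'>0$ and that $\Gamma^{(j)}_r>0$ for some $r\ge 2$. Let $h(x)=-x\log_2 x-(1-x)\log_2(1-x)$, $q_r(v)=\frac{(1+v)^r+(1-v)^r}{2}$, and let $\mathcal E$ be the set of all $(e_1,e_2)$ of the form $e_j=\frac1{\Lambda_j'}\sum_{l_1,l_2} l_j\Lambda_{l_1,l_2}\,\sigma(l_1,l_2)$,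 $j=1,2$, with $0\le\sigma(l_1,l_2)\le 1$. Whenever the equations $$\frac{v_j}{\Gamma'^{(j)}}\sum_r r\,\Gamma^{(j)}_r\,\frac{(1+v_j)^{r-1}-(1-v_j)^{r-1}}{(1+v_j)^r+(1-v_j)^r}=e_j,\qquad \frac1{\Lambda_j'}\sum_{l_1,l_2} l_j\Lambda_{l_1,l_2}\,\frac{u_1^{l_1}u_2^{l_2}}{1+u_1^{l_1}u_2^{l_2}}=e_j\qquad(j=1,2)$$ have a solution $u_1,u_2,v_1,v_2>0$, let $$\theta(e_1,e_2)=\sum_{l_1,l_2}\Lambda_{l_1,l_2}\log_2\bigl(1+u_1^{l_1}u_2^{l_2}\bigr)-\sum_{j=1}^2\Lambda_j'e_j\log_2u_j+\sum_{j=1}^2\Bigl(\frac{\Lambda_j'}{\Gamma'^{(j)}}\sum_r\Gamma^{(j)}_r\log_2q_r(v_j)-\Lambda_j'e_j\log_2v_j\Bigr)-\sum_{j=1}^2\Lambda_j'h(e_j)-R_{\mathrm{des}}.$$ Then $\theta(e_1,e_2)$ does not depend on the choice of the positive solution; the supremum $\sup_{(e_1,e_2)\in\mathcal E}\theta(e_1,e_2)$,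 taken over the points of $\mathcal E$ at which $\theta$ is defined, is finite and is over a non-empty set; and $$\lim_{n\to\infty}\frac{\log_2\mathbb E[N]}{n}=\sup_{(e_1,e_2)\in\mathcal E}\theta(e_1,e_2)+R_{\mathrm{des}}.$$ Here $N$ is the number of codewords of the code of a uniformly random graph of the two edge type LDPC ensemble with $n$ variable nodes: for each type $j$, the type $j$ sockets of the variable nodes are matched with the sockets of the type $j$ check nodes by a bijection (multiple edges are allowed), the two bijections are independent and uniformly distributed, and a codeword is an assignment of bits to the variable nodes such that at every check node of either type the bits at its edges sum to $0$ modulo $2$. The limit is along any sequence of such ensembles whose block lengths $n$ tend to infinity and which have degree distribution $(\Lambda,\Gamma^{(1)},\Gamma^{(2)})$: only degrees with positive mass occur, and the fractions of the variable nodes and of the check nodes of each type that have a given degree are equal to, or at least converge to, the prescribed ones. -/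

import Mathlib

open scoped BigOperators

noncomputable section

namespace TwoEdgeLDPC

/-- A degree distribution from the node perspective, for two edge types (indexed by `Fin 2`).
`Λ l` is the fraction of variable nodes having `l 0` edges of type one and `l 1` edges of type two;
`Γ j r` is the fraction of the check nodes of type `j` that have degree `r`. -/
structure DegreeDist where
  Λ : (Fin 2 → ℕ) →₀ ℝ
  Γ : Fin 2 → ℕ →₀ ℝ
  Λ_nonneg : ∀ l, 0 ≤ Λ l
  Γ_nonneg : ∀ j r, 0 ≤ Γ j r
  Λ_sum : ∑ l ∈ Λ.support, Λ l = 1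
  Γ_sum : ∀ j, ∑ r ∈ (Γ j).support, Γ j r = 1

namespace DegreeDist

variable (D : DegreeDist)

/-- `Λ_j'(1,1)`: the average number of type `j` edges at a variable node. -/
def avgVar (j : Fin 2) : ℝ := ∑ l ∈ D.Λ.support, (l j : ℝ) * D.Λ l

/-- `Γ^(j)'(1)`: the average degree of a check node of type `j`. -/
def avgCheck (j : Fin 2) : ℝ := ∑ r ∈ (D.Γ j).support, (r : ℝ) * D.Γ j r

/-- The design rate `1 - (m₁ + m₂) / n`, where `m_j / n = Λ_j'(1,1) / Γ^(j)'(1)` is the number of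
check nodes of type `j` per variable node. -/
def designRate : ℝ := 1 - ∑ j, D.avgVar j / D.avgCheck j

/-- The region `𝓔` of normalized numbers of edges of either type that are attached to variable
nodes of value one. -/
def region : Set (Fin 2 → ℝ) :=
  {e | ∃ σ : (Fin 2 → ℕ) → ℝ, (∀ l, 0 ≤ σ l ∧ σ l ≤ 1) ∧
    ∀ j, e j = (∑ l ∈ D.Λ.support, (l j : ℝ) * D.Λ l * σ l) / D.avgVar j}

end DegreeDist

/-- The binary entropy function, in bits. -/
def entropy (x : ℝ) : ℝ := -x * Real.logb 2 x - (1 - x) * Real.logb 2 (1 - x)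

/-- `q_r(v) = ((1+v)^r + (1-v)^r) / 2`. -/
def q (r : ℕ) (v : ℝ) : ℝ := ((1 + v) ^ r + (1 - v) ^ r) / 2

/-- The monomial `u₁^{l₁} u₂^{l₂}`. -/
def mono (u : Fin 2 → ℝ) (l : Fin 2 → ℕ) : ℝ := u 0 ^ l 0 * u 1 ^ l 1

namespace DegreeDist

variable (D : DegreeDist)

/-- `u₁, u₂, v₁, v₂` are positive and solve the four saddle point equations for `(e₁, e₂)`. -/
structure IsSaddlePoint (e u v : Fin 2 → ℝ) : Prop where
  u_pos : ∀ j, 0 < u j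
  v_pos : ∀ j, 0 < v j
  check_eq : ∀ j, v j / D.avgCheck j * ∑ r ∈ (D.Γ j).support, (r : ℝ) * D.Γ j r *
    (((1 + v j) ^ (r - 1) - (1 - v j) ^ (r - 1)) / ((1 + v j) ^ r + (1 - v j) ^ r)) = e j
  var_eq : ∀ j, 1 / D.avgVar j * ∑ l ∈ D.Λ.support,
    D.Λ l * (l j : ℝ) * (mono u l / (1 + mono u l)) = e j

/-- The expression that defines `θ(e₁, e₂)`, for given `u₁, u₂, v₁, v₂`. -/
def thetaExpr (e u v : Fin 2 → ℝ) : ℝ :=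
  ∑ l ∈ D.Λ.support, D.Λ l * Real.logb 2 (1 + mono u l)
    - ∑ j, D.avgVar j * e j * Real.logb 2 (u j)
    + ∑ j, (D.avgVar j / D.avgCheck j * ∑ r ∈ (D.Γ j).support, D.Γ j r * Real.logb 2 (q r (v j))
        - D.avgVar j * e j * Real.logb 2 (v j))
    - ∑ j, D.avgVar j * entropy (e j)
    - D.designRate

/-- `θ(e₁, e₂)` is defined and equal to `t`. -/
def IsTheta (e : Fin 2 → ℝ) (t : ℝ) : Prop :=
  ∃ u v : Fin 2 → ℝ, D.IsSaddlePoint e u v ∧ t = D.thetaExpr e u v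

end DegreeDist

/-- The degree data of a two edge type ensemble of finite block length: the number of variable
nodes with each pair of degrees, and the number of check nodes of each type with each degree. Both
sides have the same number of edges of type `j`. -/
structure Ensemble where
  varCount : (Fin 2 → ℕ) →₀ ℕ
  checkCount : Fin 2 → ℕ →₀ ℕ
  edges_match : ∀ j, ∑ l ∈ varCount.support, l j * varCount l =
    ∑ r ∈ (checkCount j).support, r * checkCount j r

namespace Ensemble

variable (E : Ensemble)

/-- The number `n` of variable nodes. -/
def blockLength : ℕ := ∑ l ∈ E.varCount.support, E.varCount l

/-- The number `m_j` of check nodes of type `j`. -/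
def numChecks (j : Fin 2) : ℕ := ∑ r ∈ (E.checkCount j).support, E.checkCount j r

/-- Variable nodes: `⟨l, i⟩` is the `i`-th one with the degrees `l`. -/
abbrev VarNode : Type := Σ l : E.varCount.support, Fin (E.varCount l.1)

/-- Check nodes of type `j`: `⟨r, i⟩` is the `i`-th one with degree `r`. -/
abbrev CheckNode (j : Fin 2) : Type := Σ r : (E.checkCount j).support, Fin (E.checkCount j r.1)

/-- Sockets for type `j` edges on the variable node side. -/
abbrev VarSocket (j : Fin 2) : Type := Σ x : E.VarNode, Fin (x.1.1 j)

/-- Sockets for type `j` edges on the check node side. -/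
abbrev CheckSocket (j : Fin 2) : Type := Σ c : E.CheckNode j, Fin c.1.1

/-- A graph of the ensemble: for either edge type, a bijection between the variable side sockets
and the check side sockets (so multiple edges between two nodes are allowed). -/
abbrev Graph : Type := ∀ j : Fin 2, E.VarSocket j ≃ E.CheckSocket j

/-- The codewords of the code of a graph: at every check node, of either type, the values of
the adjacent variable nodes, counted with multiplicity, sum to zero modulo two. -/
def IsCodeword {E : Ensemble} (G : E.Graph) (w : E.VarNode → ZMod 2) : Prop :=
  ∀ (j : Fin 2) (c : E.CheckNode j), ∑ s : Fin c.1.1, w ((G j).symm ⟨c, s⟩).1 = 0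

open Classical in
/-- `N`: the number of codewords of the code of a graph. -/
def numCodewords {E : Ensemble} (G : E.Graph) : ℕ :=
  (Finset.univ.filter fun w : E.VarNode → ZMod 2 => IsCodeword G w).card

/-- `𝔼[N]` for a graph that is uniformly distributed over the ensemble. -/
def expectedCodewords : ℝ :=
  (∑ G : E.Graph, (numCodewords G : ℝ)) / (Fintype.card E.Graph : ℝ)

end Ensemble

/-- The ensembles `E 0, E 1, …` have the degree distribution `D` as their block length goes to
infinity: only degrees that have positive mass in `D` occur, and the fractions of the nodes of each
degree tend to those prescribed by `D`. This includes all sequences whose fractions are equal to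
those of `D` for every `k`. -/
structure HasDegreeDist (E : ℕ → Ensemble) (D : DegreeDist) : Prop where
  blockLength_tendsto : Filter.Tendsto (fun k => (E k).blockLength) Filter.atTop Filter.atTop
  varCount_eq_zero : ∀ k l, D.Λ l = 0 → (E k).varCount l = 0
  checkCount_eq_zero : ∀ k j r, D.Γ j r = 0 → (E k).checkCount j r = 0
  var_tendsto : ∀ l, Filter.Tendsto
    (fun k => ((E k).varCount l : ℝ) / ((E k).blockLength : ℝ)) Filter.atTop (nhds (D.Λ l))
  check_tendsto : ∀ j r, Filter.Tendsto
    (fun k => ((E k).checkCount j r : ℝ) / ((E k).numChecks j : ℝ)) Filter.atTop (nhds (D.Γ j r))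

end TwoEdgeLDPC

end

/-!
Sort the words by their type, the numbers of ones among the variable nodes of each pair of degrees.
Under random matchings the check side sockets of type `j` carry a uniformly random word whose weight
is determined by the type, so the expected number of codewords is a sum over types of an explicit
product of binomial coefficients and of coefficients of the polynomials `∏ q_r`. There are only
polynomially many types, so the exponential growth rate is that of the largest term.

The coefficient of `v ^ w` in `∏ q_r` is at most `∏ q_r(v) / v ^ w` for every `v > 0`, and it is at
least the number of check side words with prescribed numbers of words of each weight at the check
nodes of each degree. By Gibbs' inequality the two bounds have the same exponent at the saddle
point `v`, where the words are distributed with probabilities proportional to `v ^ weight`; the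
saddle point `u` maximizes the entropy of the variable nodes, given the numbers of edges, in the
same way. Both saddle points exist in the interior, as minimizers of coercive functions, and they
are global minimizers of the expression for `θ`, which is therefore independent of the choice.
Types on the boundary, at which there may be no saddle point, are limits of types in the interior.
-/

noncomputable section

namespace TwoEdgeLDPC

open Finset Real Filter Topology Polynomial

/-! ### Bipartite matchings and words of even weight -/

section BinaryWords

variable {α β γ κ M : Type*} [Fintype α] [Fintype β] [Fintype γ] [Fintype κ]

lemma zmod_two_eq_ite (z : ZMod 2) : z = if z ≠ 0 then 1 else 0 := by
  revert z; decide

lemma sum_eq_cast_hammingNorm (x : α → ZMod 2) : ∑ a, x a = (hammingNorm x : ZMod 2) := by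
  rw [hammingNorm, card_filter, Nat.cast_sum]
  refine sum_congr rfl fun a _ => ?_
  conv_lhs => rw [zmod_two_eq_ite (x a)]
  push_cast
  rfl

lemma sum_eq_zero_iff_even_hammingNorm (x : α → ZMod 2) :
    ∑ a, x a = 0 ↔ Even (hammingNorm x) := by
  rw [sum_eq_cast_hammingNorm, ZMod.natCast_eq_zero_iff_even]

lemma hammingNorm_sigma {A : Type*} [Zero A] [DecidableEq A] {δ : κ → Type*}
    [∀ c, Fintype (δ c)] (x : (Σ c, δ c) → A) :
    hammingNorm x = ∑ c, hammingNorm fun s => x ⟨c, s⟩ := by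
  simp only [hammingNorm, card_filter]
  exact Fintype.sum_sigma _

lemma hammingNorm_comp_equiv {A : Type*} [Zero A] [DecidableEq A] (x : α → A) (σ : β ≃ α) :
    hammingNorm (x ∘ σ) = hammingNorm x := by
  simp only [hammingNorm, card_filter]
  exact Equiv.sum_comp σ fun a => if x a ≠ 0 then 1 else 0

lemma bijective_support_zmod_two :
    Function.Bijective fun x : α → ZMod 2 => ({a | x a ≠ 0} : Finset α) := by
  classical
  refine ⟨fun x y hxy => funext fun a => ?_, fun s => ⟨fun a => if a ∈ s then 1 else 0, ?_⟩⟩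
  · have h : x a ≠ 0 ↔ y a ≠ 0 := by simpa using congrArg (a ∈ ·) hxy
    rw [zmod_two_eq_ite (x a), zmod_two_eq_ite (y a)]
    simp only [h]
  · ext a
    simp

lemma sum_apply_hammingNorm [DecidableEq α] [AddCommMonoid M] (f : ℕ → M) :
    ∑ x : α → ZMod 2, f (hammingNorm x) =
      ∑ m ∈ range (Fintype.card α + 1), (Fintype.card α).choose m • f m := by
  rw [← card_univ, ← sum_powerset_apply_card f, powerset_univ]
  exact Fintype.sum_bijective _ bijective_support_zmod_two _ _ fun _ => rfl

lemma card_hammingNorm_eq [DecidableEq α] (k : ℕ) :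
    #{x : α → ZMod 2 | hammingNorm x = k} = (Fintype.card α).choose k := by
  rw [card_filter, sum_apply_hammingNorm fun m => if m = k then 1 else 0]
  simp only [smul_eq_mul, mul_ite, mul_one, mul_zero, sum_ite_eq', mem_range, ite_eq_left_iff]
  exact fun h => (Nat.choose_eq_zero_of_lt (by omega)).symm

lemma sum_range_even [AddCommMonoid M] (f : ℕ → M) (r : ℕ) :
    ∑ m ∈ range (r + 1) with Even m, f m = ∑ a ∈ range (r / 2 + 1), f (2 * a) := by
  symm
  refine sum_nbij (fun a => 2 * a) (fun a ha => ?_) (fun a _ b _ hab => ?_) (fun m hm => ?_)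
    fun _ _ => rfl
  · simp only [mem_range, mem_filter] at ha ⊢
    exact ⟨by omega, even_two_mul a⟩
  · simpa using hab
  · simp only [coe_filter, mem_range, Set.mem_ofPred_eq] at hm
    obtain ⟨a, ha⟩ := hm.2
    exact ⟨a, by simp only [coe_range, Set.mem_Iio]; omega, by simp only; omega⟩

/-- The weight enumerator of the binary words of length `r` that have even weight. -/
def evenPoly (r : ℕ) : ℕ[X] :=
  ∑ a ∈ range (r / 2 + 1), monomial (2 * a) (r.choose (2 * a))

lemma coeff_zero_evenPoly (r : ℕ) : (evenPoly r).coeff 0 = 1 := by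
  simp [evenPoly, finsetSum_coeff, coeff_monomial]

lemma natDegree_evenPoly_le (r : ℕ) : (evenPoly r).natDegree ≤ 2 * (r / 2) :=
  natDegree_sum_le_of_forall_le _ _ fun a ha => (natDegree_monomial_le _).trans <| by
    simp only [mem_range] at ha
    omega

lemma sum_X_pow_hammingNorm_even (r : ℕ) :
    ∑ y : Fin r → ZMod 2 with ∑ s, y s = 0, (X : ℕ[X]) ^ hammingNorm y = evenPoly r := by
  simp only [sum_eq_zero_iff_even_hammingNorm]
  rw [sum_filter, sum_apply_hammingNorm fun m => if Even m then (X : ℕ[X]) ^ m else 0,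
    Fintype.card_fin]
  simp only [smul_ite, smul_zero]
  rw [← sum_filter, sum_range_even fun m => r.choose m • (X : ℕ[X]) ^ m]
  refine sum_congr rfl fun a _ => ?_
  rw [X_pow_eq_monomial, smul_monomial, smul_eq_mul, mul_one]

lemma sum_X_pow_hammingNorm_checks [DecidableEq κ] (r : κ → ℕ) :
    ∑ y : (Σ c, Fin (r c)) → ZMod 2 with ∀ c, ∑ s, y ⟨c, s⟩ = 0, (X : ℕ[X]) ^ hammingNorm y =
      ∏ c, evenPoly (r c) := by
  simp only [← sum_X_pow_hammingNorm_even]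
  rw [prod_univ_sum]
  refine sum_equiv (Equiv.piCurry fun _ _ => ZMod 2) (fun y => ?_) fun y _ => ?_
  · simp [Fintype.mem_piFinset, Sigma.curry]
  · rw [hammingNorm_sigma, prod_pow_eq_pow_sum]
    rfl

lemma card_checks_hammingNorm_eq [DecidableEq κ] (r : κ → ℕ) (k : ℕ) :
    #{y : (Σ c, Fin (r c)) → ZMod 2 | (∀ c, ∑ s, y ⟨c, s⟩ = 0) ∧ hammingNorm y = k} =
      (∏ c, evenPoly (r c)).coeff k := by
  rw [← sum_X_pow_hammingNorm_checks, finsetSum_coeff]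
  simp only [coeff_X_pow]
  rw [← filter_filter, card_filter]
  simp only [eq_comm]

lemma card_equiv_comp_symm_eq [DecidableEq α] [DecidableEq β] [DecidableEq γ]
    (x : α → γ) (y : β → γ)
    (hfib : ∀ c, Fintype.card {a // x a = c} = Fintype.card {b // y b = c}) :
    #{σ : α ≃ β | x ∘ σ.symm = y} = ∏ c, (Fintype.card {a // x a = c}).factorial := by
  let τ : α ≃ β := Equiv.ofFiberEquiv fun c => Fintype.equivOfCardEq (hfib c)
  have hτ : x ∘ τ.symm = y :=
    (Equiv.comp_symm_eq τ y x).2 (funext fun a => (Equiv.ofFiberEquiv_map _ a).symm)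
  rw [← DomMulAct.stabilizer_card, Fintype.card_subtype]
  refine card_equiv (Equiv.equivCongr (Equiv.refl α) τ.symm) fun σ => ?_
  simp only [mem_filter, mem_univ, true_and]
  rw [Equiv.comp_symm_eq, ← hτ, eq_comm]
  rfl

lemma card_fiber_zmod_two (x : α → ZMod 2) :
    Fintype.card {a // x a = 0} = Fintype.card α - hammingNorm x ∧
      Fintype.card {a // x a = 1} = hammingNorm x := by
  have hone : ∀ z : ZMod 2, z = 1 ↔ ¬ z = 0 := by decide
  have hcard := card_filter_add_card_filter_not (s := (univ : Finset α)) (fun a => x a = 0)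
  rw [card_univ] at hcard
  simp only [Fintype.card_subtype, hone, hammingNorm, ne_eq]
  exact ⟨by omega, trivial⟩

lemma card_equiv_comp_symm_eq_zmod_two [DecidableEq α] [DecidableEq β]
    {x : α → ZMod 2} {y : β → ZMod 2} (hcard : Fintype.card α = Fintype.card β)
    (hxy : hammingNorm x = hammingNorm y) :
    #{σ : α ≃ β | x ∘ σ.symm = y} =
      (hammingNorm x).factorial * (Fintype.card α - hammingNorm x).factorial := by
  obtain ⟨hx0, hx1⟩ := card_fiber_zmod_two x
  obtain ⟨hy0, hy1⟩ := card_fiber_zmod_two y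
  have huniv : (univ : Finset (ZMod 2)) = {0, 1} := rfl
  rw [card_equiv_comp_symm_eq, huniv, prod_pair (by decide), hx0, hx1, mul_comm]
  intro c
  obtain rfl | rfl : c = 0 ∨ c = 1 := by revert c; decide
  · rw [hx0, hy0, hcard, hxy]
  · rw [hx1, hy1, hxy]

lemma card_equiv_checks [DecidableEq α] [DecidableEq κ] {r : κ → ℕ} (x : α → ZMod 2)
    (hcard : Fintype.card α = Fintype.card (Σ c, Fin (r c))) :
    #{σ : α ≃ Σ c, Fin (r c) | ∀ c, ∑ s, x (σ.symm ⟨c, s⟩) = 0} =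
      (∏ c, evenPoly (r c)).coeff (hammingNorm x) *
        ((hammingNorm x).factorial * (Fintype.card α - hammingNorm x).factorial) := by
  rw [← card_checks_hammingNorm_eq, card_eq_sum_card_fiberwise (f := fun σ => x ∘ σ.symm)
      (t := {y | (∀ c, ∑ s, y ⟨c, s⟩ = 0) ∧ hammingNorm y = hammingNorm x}),
    ← smul_eq_mul, ← sum_const]
  · refine sum_congr rfl fun y hy => ?_
    simp only [mem_filter, mem_univ, true_and] at hy
    rw [filter_filter, ← card_equiv_comp_symm_eq_zmod_two hcard hy.2.symm]
    congr 1 with σ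
    simp only [mem_filter, mem_univ, true_and, and_iff_right_iff_imp]
    rintro rfl
    exact hy.1
  · intro σ hσ
    simp only [coe_filter, mem_univ, true_and, Set.mem_ofPred_eq] at hσ ⊢
    exact ⟨hσ, hammingNorm_comp_equiv x σ.symm⟩

end BinaryWords

/-! ### The types of the codewords -/

namespace Ensemble

/-- The number of edges of type `j`. -/
def numEdges (E : Ensemble) (j : Fin 2) : ℕ := ∑ l ∈ E.varCount.support, l j * E.varCount l

/-- The weight enumerator of the words on the check side sockets of type `j` that satisfy all checks
of type `j`. -/
def checkPoly (E : Ensemble) (j : Fin 2) : ℕ[X] :=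
  ∏ r ∈ (E.checkCount j).support, evenPoly r ^ E.checkCount j r

/-- The contribution to the expected number of codewords of the words of type `k`, that is, the
words with `k l` ones among the variable nodes of degrees `l`, for every `l`. -/
def typeTerm (E : Ensemble) (k : (Fin 2 → ℕ) → ℕ) : ℝ :=
  (∏ l ∈ E.varCount.support, ((E.varCount l).choose (k l) : ℝ)) *
    ∏ j, ((E.checkPoly j).coeff (∑ l ∈ E.varCount.support, l j * k l) : ℝ) /
      (E.numEdges j).choose (∑ l ∈ E.varCount.support, l j * k l)

variable {E : Ensemble}

/-- The number of edges of type `j` that are attached to variable nodes of value one. -/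
def edgeWeight (w : E.VarNode → ZMod 2) (j : Fin 2) : ℕ :=
  hammingNorm fun s : E.VarSocket j => w s.1

/-- The number of variable nodes of degree `l` that have value one. -/
def typeOf (w : E.VarNode → ZMod 2) (l : E.varCount.support) : ℕ := hammingNorm fun i => w ⟨l, i⟩

lemma card_varSocket (E : Ensemble) (j : Fin 2) :
    Fintype.card (E.VarSocket j) = E.numEdges j := by
  rw [numEdges, Fintype.card_sigma, Fintype.sum_sigma,
    ← sum_coe_sort _ fun l => l j * E.varCount l]
  simp [mul_comm]

lemma card_checkSocket (E : Ensemble) (j : Fin 2) :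
    Fintype.card (E.CheckSocket j) = E.numEdges j := by
  rw [numEdges, E.edges_match, Fintype.card_sigma, Fintype.sum_sigma,
    ← sum_coe_sort _ fun r => r * E.checkCount j r]
  simp [mul_comm]

lemma card_graph (E : Ensemble) : Fintype.card E.Graph = ∏ j, (E.numEdges j).factorial := by
  rw [Fintype.card_pi]
  refine prod_congr rfl fun j _ => ?_
  rw [Fintype.card_equiv (Fintype.equivOfCardEq (by rw [card_varSocket, card_checkSocket])),
    card_varSocket]

lemma prod_evenPoly_checkNode (E : Ensemble) (j : Fin 2) :
    ∏ c : E.CheckNode j, evenPoly c.1.1 = E.checkPoly j := by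
  rw [Fintype.prod_sigma, checkPoly, ← prod_coe_sort _ fun r => evenPoly r ^ E.checkCount j r]
  simp

lemma edgeWeight_le (w : E.VarNode → ZMod 2) (j : Fin 2) : edgeWeight w j ≤ E.numEdges j := by
  rw [← card_varSocket]
  exact hammingNorm_le_card_fintype

lemma edgeWeight_eq_sum (w : E.VarNode → ZMod 2) (j : Fin 2) :
    edgeWeight w j = ∑ l : E.varCount.support, l.1 j * typeOf w l := by
  rw [edgeWeight, hammingNorm_sigma, Fintype.sum_sigma]
  refine sum_congr rfl fun l _ => ?_
  rw [typeOf, hammingNorm, card_filter, mul_sum]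
  refine sum_congr rfl fun i _ => ?_
  by_cases h : w ⟨l, i⟩ = 0 <;> simp [hammingNorm, h]

lemma card_isCodeword (w : E.VarNode → ZMod 2) [DecidablePred fun G : E.Graph => IsCodeword G w] :
    #{G : E.Graph | IsCodeword G w} = ∏ j, (E.checkPoly j).coeff (edgeWeight w j) *
      ((edgeWeight w j).factorial * (E.numEdges j - edgeWeight w j).factorial) := by
  classical
  have hmatchings : ∀ j, #{σ : E.VarSocket j ≃ E.CheckSocket j |
        ∀ c : E.CheckNode j, ∑ s, w (σ.symm ⟨c, s⟩).1 = 0} =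
      (E.checkPoly j).coeff (edgeWeight w j) *
        ((edgeWeight w j).factorial * (E.numEdges j - edgeWeight w j).factorial) := by
    intro j
    have hcard : Fintype.card (E.VarSocket j) = Fintype.card (E.CheckSocket j) := by
      rw [card_varSocket, card_checkSocket]
    have hcount := card_equiv_checks (κ := E.CheckNode j) (r := fun c => c.1.1)
      (fun s : E.VarSocket j => w s.1) hcard
    rw [prod_evenPoly_checkNode, card_varSocket] at hcount
    exact hcount
  simp only [← hmatchings]
  rw [← Fintype.card_piFinset]
  congr 1 with G
  simp [IsCodeword, Fintype.mem_piFinset]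

lemma expectedCodewords_eq_sum (E : Ensemble) :
    E.expectedCodewords = ∑ w : E.VarNode → ZMod 2, ∏ j,
      ((E.checkPoly j).coeff (edgeWeight w j) : ℝ) / (E.numEdges j).choose (edgeWeight w j) := by
  classical
  have hcount : ∑ G : E.Graph, numCodewords G =
      ∑ w : E.VarNode → ZMod 2, ∏ j, (E.checkPoly j).coeff (edgeWeight w j) *
        ((edgeWeight w j).factorial * (E.numEdges j - edgeWeight w j).factorial) := by
    simp only [numCodewords, card_filter]
    rw [sum_comm]
    exact sum_congr rfl fun w _ => by rw [← card_filter, card_isCodeword]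
  rw [expectedCodewords, ← Nat.cast_sum, hcount, card_graph, Nat.cast_sum, sum_div]
  refine sum_congr rfl fun w _ => ?_
  rw [Nat.cast_prod, Nat.cast_prod, ← prod_div_distrib]
  refine prod_congr rfl fun j _ => ?_
  rw [Nat.cast_choose ℝ (edgeWeight_le w j)]
  push_cast
  have := Nat.factorial_ne_zero (E.numEdges j)
  field_simp

lemma card_typeOf_eq (k : E.varCount.support → ℕ) :
    #{w : E.VarNode → ZMod 2 | typeOf w = k} = ∏ l, (E.varCount l.1).choose (k l) := by
  classical
  have hfiber : ∀ l : E.varCount.support,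
      #{x : Fin (E.varCount l.1) → ZMod 2 | hammingNorm x = k l} =
        (E.varCount l.1).choose (k l) := fun l => by
    rw [card_hammingNorm_eq, Fintype.card_fin]
  simp only [← hfiber]
  rw [← Fintype.card_piFinset]
  refine card_equiv
    (Equiv.piCurry fun (l : E.varCount.support) (_ : Fin (E.varCount l.1)) => ZMod 2) fun w => ?_
  simp only [mem_filter, mem_univ, true_and, Fintype.mem_piFinset, funext_iff]
  rfl

lemma typeTerm_nonneg (E : Ensemble) (k : (Fin 2 → ℕ) → ℕ) : 0 ≤ E.typeTerm k := by
  unfold typeTerm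
  positivity

lemma sum_typeOf_eq (E : Ensemble) (k : (Fin 2 → ℕ) → ℕ) :
    ∑ w : E.VarNode → ZMod 2 with typeOf w = fun l => k l.1, ∏ j,
      ((E.checkPoly j).coeff (edgeWeight w j) : ℝ) / (E.numEdges j).choose (edgeWeight w j) =
    E.typeTerm k := by
  have hconst : ∀ w ∈ ({w : E.VarNode → ZMod 2 | typeOf w = fun l => k l.1} : Finset _), ∏ j,
      ((E.checkPoly j).coeff (edgeWeight w j) : ℝ) / (E.numEdges j).choose (edgeWeight w j) =
      ∏ j, ((E.checkPoly j).coeff (∑ l ∈ E.varCount.support, l j * k l) : ℝ) /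
      (E.numEdges j).choose (∑ l ∈ E.varCount.support, l j * k l) := by
    intro w hw
    simp only [mem_filter, mem_univ, true_and] at hw
    refine prod_congr rfl fun j _ => ?_
    rw [edgeWeight_eq_sum, hw, sum_coe_sort E.varCount.support fun l => l j * k l]
  rw [sum_congr rfl hconst, sum_const, card_typeOf_eq, nsmul_eq_mul, typeTerm, Nat.cast_prod,
    prod_coe_sort E.varCount.support fun l => ((E.varCount l).choose (k l) : ℝ)]

lemma typeTerm_le_expectedCodewords (E : Ensemble) (k : (Fin 2 → ℕ) → ℕ) :
    E.typeTerm k ≤ E.expectedCodewords := by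
  rw [← sum_typeOf_eq, expectedCodewords_eq_sum]
  exact sum_le_sum_of_subset_of_nonneg (filter_subset _ _) fun w _ _ => by positivity

lemma expectedCodewords_pos (E : Ensemble) : 0 < E.expectedCodewords := by
  have hcoeff : ∀ j, (E.checkPoly j).coeff 0 = 1 := fun j => by
    rw [coeff_zero_eq_eval_zero, checkPoly, eval_prod]
    simp [← coeff_zero_eq_eval_zero, coeff_zero_evenPoly]
  refine lt_of_lt_of_le ?_ (E.typeTerm_le_expectedCodewords 0)
  simp [typeTerm, hcoeff]

lemma expectedCodewords_eq_sum_typeTerm (E : Ensemble) :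
    E.expectedCodewords =
      ∑ k ∈ Fintype.piFinset fun l : E.varCount.support => range (E.varCount l + 1),
        E.typeTerm (Function.extend Subtype.val k 0) := by
  classical
  have hmaps : ∀ w ∈ (univ : Finset (E.VarNode → ZMod 2)),
      typeOf w ∈ Fintype.piFinset fun l : E.varCount.support => range (E.varCount l + 1) := by
    simp only [Fintype.mem_piFinset, mem_range, Nat.lt_succ_iff]
    exact fun w _ l => hammingNorm_le_card_fintype.trans (Fintype.card_fin _).le
  rw [expectedCodewords_eq_sum, ← sum_fiberwise_of_maps_to hmaps]
  refine sum_congr rfl fun k _ => ?_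
  rw [← sum_typeOf_eq]
  simp only [Subtype.val_injective.extend_apply]

lemma varCount_le_blockLength (E : Ensemble) (l : Fin 2 → ℕ) : E.varCount l ≤ E.blockLength := by
  by_cases h : l ∈ E.varCount.support
  · exact single_le_sum (f := E.varCount) (fun _ _ => Nat.zero_le _) h
  · simp [Finsupp.notMem_support_iff.1 h]

lemma exists_expectedCodewords_le (E : Ensemble) : ∃ k : (Fin 2 → ℕ) → ℕ,
    (∀ l, k l ≤ E.varCount l) ∧
      E.expectedCodewords ≤ (E.blockLength + 1 : ℝ) ^ #E.varCount.support * E.typeTerm k := by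
  obtain ⟨k, hk, hmax⟩ := exists_max_image
    (Fintype.piFinset fun l : E.varCount.support => range (E.varCount l + 1))
    (fun k => E.typeTerm (Function.extend Subtype.val k 0)) ⟨0, by simp⟩
  simp only [Fintype.mem_piFinset, mem_range, Nat.lt_succ_iff] at hk
  refine ⟨Function.extend Subtype.val k 0, fun l => ?_, ?_⟩
  · by_cases hl : l ∈ E.varCount.support
    · exact (Subtype.val_injective.extend_apply k 0 ⟨l, hl⟩).trans_le (hk ⟨l, hl⟩)
    · rw [Function.extend_apply' _ _ _ (by simpa using hl)]
      exact Nat.zero_le _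
  · rw [expectedCodewords_eq_sum_typeTerm]
    refine (sum_le_card_nsmul _ _ _ hmax).trans ?_
    rw [nsmul_eq_mul, Fintype.card_piFinset]
    refine mul_le_mul_of_nonneg_right ?_ (E.typeTerm_nonneg _)
    simp only [card_range]
    push_cast
    calc ∏ l : E.varCount.support, ((E.varCount l : ℝ) + 1)
        ≤ ∏ _l : E.varCount.support, (E.blockLength + 1 : ℝ) := by
          gcongr with l
          exact E.varCount_le_blockLength l
      _ = (E.blockLength + 1 : ℝ) ^ #E.varCount.support := by simp

end Ensemble

/-! ### Entropies and tilted types -/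

section Gibbs

variable {ι : Type*} {s : Finset ι} {p z : ι → ℝ}

lemma sum_negMulLog_add_mul_log_le (hp : ∀ i ∈ s, 0 ≤ p i) (hsum : ∑ i ∈ s, p i = 1)
    (hz : ∀ i ∈ s, 0 < z i) :
    ∑ i ∈ s, (negMulLog (p i) + p i * log (z i)) ≤ log (∑ i ∈ s, z i) := by
  have hZ : 0 < ∑ i ∈ s, z i := sum_pos hz (nonempty_of_sum_ne_zero (hsum.trans_ne one_ne_zero))
  set Z := ∑ i ∈ s, z i with hZdef
  have hterm : ∀ i ∈ s, negMulLog (p i) + p i * log (z i) ≤ z i / Z - p i + p i * log Z := by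
    intro i hi
    have hzi := hz i hi
    rcases (hp i hi).eq_or_lt with h0 | h0
    · rw [← h0]
      simp [div_nonneg hzi.le hZ.le]
    · have hlog := mul_le_mul_of_nonneg_left
        (log_le_sub_one_of_pos (x := z i / Z / p i) (by positivity)) h0.le
      have hmul : p i * (z i / Z / p i - 1) = z i / Z - p i := by field_simp
      rw [log_div (by positivity) h0.ne', log_div hzi.ne' hZ.ne', hmul] at hlog
      rw [negMulLog]
      linarith
  refine (sum_le_sum hterm).trans ?_
  rw [sum_add_distrib, sum_sub_distrib, ← sum_div, ← sum_mul, hsum, ← hZdef, div_self hZ.ne']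
  simp

lemma sum_negMulLog_add_mul_log_eq (hs : s.Nonempty) (hz : ∀ i ∈ s, 0 < z i) :
    ∑ i ∈ s, (negMulLog (z i / ∑ i ∈ s, z i) + z i / (∑ i ∈ s, z i) * log (z i)) =
      log (∑ i ∈ s, z i) := by
  have hZ : 0 < ∑ i ∈ s, z i := sum_pos hz hs
  set Z := ∑ i ∈ s, z i with hZdef
  have hterm : ∀ i ∈ s, negMulLog (z i / Z) + z i / Z * log (z i) = z i / Z * log Z := by
    intro i hi
    rw [negMulLog, log_div (hz i hi).ne' hZ.ne']
    ring
  rw [sum_congr rfl hterm, ← sum_mul, ← sum_div, ← hZdef, div_self hZ.ne', one_mul]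

lemma binEntropy_add_mul_log_le {x m : ℝ} (hx0 : 0 ≤ x) (hx1 : x ≤ 1) (hm : 0 < m) :
    binEntropy x + x * log m ≤ log (1 + m) := by
  have hGibbs := sum_negMulLog_add_mul_log_le (s := univ) (p := ![1 - x, x]) (z := ![1, m])
    (by simp [Fin.forall_fin_two, hx0, hx1]) (by simp) (by simp [Fin.forall_fin_two, hm])
  simp only [Fin.sum_univ_two, Matrix.cons_val_zero, Matrix.cons_val_one, log_one] at hGibbs
  rw [binEntropy_eq_negMulLog_add_negMulLog_one_sub]
  linarith

lemma binEntropy_add_mul_log_eq {m : ℝ} (hm : 0 < m) :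
    binEntropy (m / (1 + m)) + m / (1 + m) * log m = log (1 + m) := by
  have hGibbs := sum_negMulLog_add_mul_log_eq (z := ![1, m]) univ_nonempty
    (by simp [Fin.forall_fin_two, hm])
  simp only [Fin.sum_univ_two, Matrix.cons_val_zero, Matrix.cons_val_one, log_one] at hGibbs
  have hsub : 1 - m / (1 + m) = 1 / (1 + m) := by field_simp; ring
  rw [binEntropy_eq_negMulLog_add_negMulLog_one_sub, hsub]
  linarith

end Gibbs

lemma entropy_eq_binEntropy_div (x : ℝ) : entropy x = binEntropy x / log 2 := by
  rw [entropy, binEntropy_eq_negMulLog_add_negMulLog_one_sub, negMulLog, negMulLog, logb, logb]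
  ring

section EvenWords

/-- The contribution to `q r v` of the even words with `2 * a` ones. -/
def qTerm (r : ℕ) (v : ℝ) (a : ℕ) : ℝ := (r.choose (2 * a) : ℝ) * v ^ (2 * a)

/-- The mean weight of an even word of length `r` whose weight is `2 * a` with probability `p a`. -/
def meanWeight (r : ℕ) (p : ℕ → ℝ) : ℝ := ∑ a ∈ range (r / 2 + 1), ((2 * a : ℕ) : ℝ) * p a

/-- The exponential growth rate, in `m`, of the number of `m`-tuples of even words of length `r` of
which a fraction `p a` has weight `2 * a`. -/
def evenEntropy (r : ℕ) (p : ℕ → ℝ) : ℝ :=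
  ∑ a ∈ range (r / 2 + 1), (negMulLog (p a) + p a * log (r.choose (2 * a)))

/-- The distribution of half the weight of a random even word of length `r` that is chosen with
probability proportional to `v ^ weight`. -/
def checkTilt (r : ℕ) (v : ℝ) (a : ℕ) : ℝ := qTerm r v a / q r v

variable {r a : ℕ} {v : ℝ}

lemma choose_two_mul_pos (ha : a ∈ range (r / 2 + 1)) : 0 < r.choose (2 * a) :=
  Nat.choose_pos (by simp only [mem_range] at ha; omega)

lemma qTerm_pos (hv : 0 < v) (ha : a ∈ range (r / 2 + 1)) : 0 < qTerm r v a := by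
  have := choose_two_mul_pos ha
  rw [qTerm]
  positivity

lemma q_eq_sum_qTerm (r : ℕ) (v : ℝ) : q r v = ∑ a ∈ range (r / 2 + 1), qTerm r v a := by
  simp only [qTerm]
  rw [← sum_range_even fun m => (r.choose m : ℝ) * v ^ m, sum_filter, q, sub_eq_add_neg,
    add_comm 1 v, add_comm 1 (-v), add_pow, add_pow, ← sum_add_distrib, sum_div]
  refine sum_congr rfl fun m _ => ?_
  rcases Nat.even_or_odd m with h | h
  · rw [if_pos h, h.neg_pow, one_pow]
    ring
  · rw [if_neg (Nat.not_even_iff_odd.2 h), h.neg_pow, one_pow]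
    ring

lemma eval₂_evenPoly (r : ℕ) (v : ℝ) : (evenPoly r).eval₂ (Nat.castRingHom ℝ) v = q r v := by
  rw [evenPoly, Polynomial.eval₂_finsetSum, q_eq_sum_qTerm]
  simp [Polynomial.eval₂_monomial, qTerm]

lemma q_pos (r : ℕ) (hv : 0 < v) : 0 < q r v := by
  rw [q_eq_sum_qTerm]
  exact sum_pos (fun a ha => qTerm_pos hv ha) nonempty_range_add_one

lemma hasDerivAt_q (r : ℕ) (v : ℝ) :
    HasDerivAt (q r) (r * ((1 + v) ^ (r - 1) - (1 - v) ^ (r - 1)) / 2) v := by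
  have hadd : HasDerivAt (fun x : ℝ => 1 + x) 1 v := (hasDerivAt_id v).const_add 1
  have hsub : HasDerivAt (fun x : ℝ => 1 - x) (-1) v := (hasDerivAt_id v).const_sub 1
  refine (((hadd.pow r).add (hsub.pow r)).div_const 2).congr_deriv ?_
  ring

lemma mul_deriv_q (r : ℕ) (v : ℝ) :
    v * (r * ((1 + v) ^ (r - 1) - (1 - v) ^ (r - 1)) / 2) = meanWeight r (qTerm r v) := by
  have hsum : HasDerivAt (q r) (∑ a ∈ range (r / 2 + 1),
      (r.choose (2 * a) : ℝ) * (((2 * a : ℕ) : ℝ) * v ^ (2 * a - 1))) v := by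
    rw [funext (q_eq_sum_qTerm r)]
    exact HasDerivAt.fun_sum fun a _ => (hasDerivAt_pow (2 * a) v).const_mul _
  rw [(hasDerivAt_q r v).unique hsum, mul_sum, meanWeight]
  refine sum_congr rfl fun a _ => ?_
  rw [qTerm]
  rcases Nat.eq_zero_or_pos a with rfl | ha
  · simp
  · rw [← Nat.sub_add_cancel (show 1 ≤ 2 * a by omega), pow_succ, Nat.add_sub_cancel]
    ring

lemma meanWeight_checkTilt (r : ℕ) (v : ℝ) :
    meanWeight r (checkTilt r v) =
      v * (r * (((1 + v) ^ (r - 1) - (1 - v) ^ (r - 1)) / ((1 + v) ^ r + (1 - v) ^ r))) := by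
  have hdiv : meanWeight r (checkTilt r v) = meanWeight r (qTerm r v) / q r v := by
    simp only [meanWeight, checkTilt, sum_div, mul_div_assoc]
  rw [hdiv, ← mul_deriv_q, q, ← mul_div_assoc, ← mul_div_assoc, ← mul_div_assoc,
    div_div_div_cancel_right₀ two_ne_zero]

lemma checkTilt_pos (hv : 0 < v) (ha : a ∈ range (r / 2 + 1)) : 0 < checkTilt r v a :=
  div_pos (qTerm_pos hv ha) (q_pos r hv)

lemma sum_checkTilt (r : ℕ) (hv : 0 < v) : ∑ a ∈ range (r / 2 + 1), checkTilt r v a = 1 := by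
  simp only [checkTilt]
  rw [← sum_div, ← q_eq_sum_qTerm, div_self (q_pos r hv).ne']

lemma evenEntropy_add_meanWeight_mul_log (r : ℕ) (p : ℕ → ℝ) (hv : 0 < v) :
    evenEntropy r p + meanWeight r p * log v =
      ∑ a ∈ range (r / 2 + 1), (negMulLog (p a) + p a * log (qTerm r v a)) := by
  rw [evenEntropy, meanWeight, sum_mul, ← sum_add_distrib]
  refine sum_congr rfl fun a ha => ?_
  have := choose_two_mul_pos ha
  rw [qTerm, log_mul (by positivity) (by positivity), log_pow]
  ring

lemma evenEntropy_add_le_log_q {p : ℕ → ℝ} (hp : ∀ a ∈ range (r / 2 + 1), 0 ≤ p a)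
    (hsum : ∑ a ∈ range (r / 2 + 1), p a = 1) (hv : 0 < v) :
    evenEntropy r p + meanWeight r p * log v ≤ log (q r v) := by
  rw [evenEntropy_add_meanWeight_mul_log r p hv, q_eq_sum_qTerm]
  exact sum_negMulLog_add_mul_log_le hp hsum fun a ha => qTerm_pos hv ha

lemma evenEntropy_checkTilt_add (r : ℕ) (hv : 0 < v) :
    evenEntropy r (checkTilt r v) + meanWeight r (checkTilt r v) * log v = log (q r v) := by
  rw [evenEntropy_add_meanWeight_mul_log r _ hv]
  simp only [checkTilt, q_eq_sum_qTerm]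
  exact sum_negMulLog_add_mul_log_eq nonempty_range_add_one fun a ha => qTerm_pos hv ha

lemma log_q_nonneg (r : ℕ) (hv : 0 < v) : 0 ≤ log (q r v) := by
  refine log_nonneg ?_
  rw [q_eq_sum_qTerm]
  calc (1 : ℝ) = qTerm r v 0 := by simp [qTerm]
    _ ≤ _ := single_le_sum (f := qTerm r v) (fun a ha => (qTerm_pos hv ha).le) (by simp)

lemma mul_log_le_log_q (r : ℕ) (hv : 0 < v) :
    ((2 * (r / 2) : ℕ) : ℝ) * log v ≤ log (q r v) := by
  have hmem : r / 2 ∈ range (r / 2 + 1) := self_mem_range_succ _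
  rw [← log_pow]
  refine log_le_log (by positivity) ?_
  rw [q_eq_sum_qTerm]
  calc v ^ (2 * (r / 2)) ≤ qTerm r v (r / 2) :=
        le_mul_of_one_le_left (by positivity) (mod_cast choose_two_mul_pos hmem)
    _ ≤ _ := single_le_sum (f := qTerm r v) (fun a ha => (qTerm_pos hv ha).le) hmem

end EvenWords

lemma mono_pos {u : Fin 2 → ℝ} (hu : ∀ j, 0 < u j) (l : Fin 2 → ℕ) : 0 < mono u l :=
  mul_pos (pow_pos (hu 0) _) (pow_pos (hu 1) _)

lemma log_mono {u : Fin 2 → ℝ} (hu : ∀ j, 0 < u j) (l : Fin 2 → ℕ) :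
    log (mono u l) = ∑ j, (l j : ℝ) * log (u j) := by
  rw [mono, log_mul (pow_pos (hu 0) _).ne' (pow_pos (hu 1) _).ne', log_pow, log_pow,
    Fin.sum_univ_two]

/-- The probability of a one at a variable node of degrees `l` if a word is chosen with probability
proportional to the product of `u j ^ w j` over the edge types `j`, where `w j` is the number of
edges of type `j` at variable nodes of value one. -/
def tilt (u : Fin 2 → ℝ) (l : Fin 2 → ℕ) : ℝ := mono u l / (1 + mono u l)

lemma tilt_pos {u : Fin 2 → ℝ} (hu : ∀ j, 0 < u j) (l : Fin 2 → ℕ) : 0 < tilt u l :=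
  div_pos (mono_pos hu l) (by linarith [mono_pos hu l])

lemma tilt_lt_one {u : Fin 2 → ℝ} (hu : ∀ j, 0 < u j) (l : Fin 2 → ℕ) : tilt u l < 1 := by
  have := mono_pos hu l
  rw [tilt, div_lt_one (by linarith)]
  linarith

namespace DegreeDist

variable (D : DegreeDist)

/-- The fractions of the edges that are attached to variable nodes of value one, if the fraction
`σ l` of the variable nodes with degrees `l` has this value. -/
def edgeFrac (σ : (Fin 2 → ℕ) → ℝ) (j : Fin 2) : ℝ :=
  (∑ l ∈ D.Λ.support, (l j : ℝ) * D.Λ l * σ l) / D.avgVar j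

/-- The exponential growth rate, in the block length, of the number of words in which the fraction
`σ l` of the variable nodes with degrees `l` has the value one. -/
def varEntropy (σ : (Fin 2 → ℕ) → ℝ) : ℝ := ∑ l ∈ D.Λ.support, D.Λ l * binEntropy (σ l)

/-- The part of `thetaExpr` that is due to the variable nodes, in nats. -/
def varPart (e u : Fin 2 → ℝ) : ℝ :=
  ∑ l ∈ D.Λ.support, D.Λ l * log (1 + mono u l) - ∑ j, D.avgVar j * e j * log (u j)

/-- The part of `thetaExpr` that is due to the check nodes of type `j`, in nats. -/
def checkPart (j : Fin 2) (e v : ℝ) : ℝ :=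
  D.avgVar j / D.avgCheck j * ∑ r ∈ (D.Γ j).support, D.Γ j r * log (q r v)
    - D.avgVar j * e * log v

/-- The exponential growth rate, in the block length, of the number of check side words of type `j`,
when the fraction `p r a` of the check nodes of degree `r` has `2 * a` ones. -/
def checkEntropy (j : Fin 2) (p : ℕ → ℕ → ℝ) : ℝ :=
  D.avgVar j / D.avgCheck j * ∑ r ∈ (D.Γ j).support, D.Γ j r * evenEntropy r (p r)

/-- The exponential growth rate of the expected number of codewords in which the fraction `σ l` of
the variable nodes with degrees `l` has the value one, if the numbers of check side words are
estimated by means of `v`. -/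
def typeExponent (σ : (Fin 2 → ℕ) → ℝ) (v : Fin 2 → ℝ) : ℝ :=
  D.varEntropy σ +
    ∑ j, (D.checkPart j (D.edgeFrac σ j) (v j) - D.avgVar j * binEntropy (D.edgeFrac σ j))

lemma thetaExpr_add_designRate (e u v : Fin 2 → ℝ) :
    (D.thetaExpr e u v + D.designRate) * log 2 =
      D.varPart e u + ∑ j, (D.checkPart j (e j) (v j) - D.avgVar j * binEntropy (e j)) := by
  have hlog : log 2 ≠ 0 := (log_pos one_lt_two).ne'
  simp only [thetaExpr, varPart, checkPart, entropy_eq_binEntropy_div, logb, Fin.sum_univ_two,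
    ← mul_div_assoc, ← sum_div]
  field_simp
  ring

variable {D} {j : Fin 2}

lemma Λ_pos {l : Fin 2 → ℕ} (hl : l ∈ D.Λ.support) : 0 < D.Λ l :=
  (D.Λ_nonneg l).lt_of_ne' (Finsupp.mem_support_iff.1 hl)

lemma Γ_pos {r : ℕ} (hr : r ∈ (D.Γ j).support) : 0 < D.Γ j r :=
  (D.Γ_nonneg j r).lt_of_ne' (Finsupp.mem_support_iff.1 hr)

lemma avgVar_nonneg (D : DegreeDist) (j : Fin 2) : 0 ≤ D.avgVar j :=
  sum_nonneg fun l _ => mul_nonneg (Nat.cast_nonneg _) (D.Λ_nonneg l)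

lemma avgVar_pos (h : ∃ l, l j ≠ 0 ∧ 0 < D.Λ l) : 0 < D.avgVar j := by
  obtain ⟨l, hl, hΛ⟩ := h
  exact sum_pos' (fun l _ => mul_nonneg (Nat.cast_nonneg _) (D.Λ_nonneg l))
    ⟨l, Finsupp.mem_support_iff.2 hΛ.ne', by positivity⟩

lemma avgCheck_pos (h : ∃ r, r ≠ 0 ∧ 0 < D.Γ j r) : 0 < D.avgCheck j := by
  obtain ⟨r, hr, hΓ⟩ := h
  exact sum_pos' (fun r _ => mul_nonneg (Nat.cast_nonneg _) (D.Γ_nonneg j r))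
    ⟨r, Finsupp.mem_support_iff.2 hΓ.ne', by positivity⟩

lemma varPart_edgeFrac (hV : ∀ j, 0 < D.avgVar j) (σ : (Fin 2 → ℕ) → ℝ) {u : Fin 2 → ℝ}
    (hu : ∀ j, 0 < u j) :
    D.varPart (D.edgeFrac σ) u =
      ∑ l ∈ D.Λ.support, D.Λ l * (log (1 + mono u l) - σ l * log (mono u l)) := by
  have hedge : ∀ j, D.avgVar j * D.edgeFrac σ j = ∑ l ∈ D.Λ.support, (l j : ℝ) * D.Λ l * σ l :=
    fun j => mul_div_cancel₀ _ (hV j).ne'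
  simp only [varPart, hedge, sum_mul]
  rw [sum_comm, ← sum_sub_distrib]
  refine sum_congr rfl fun l _ => ?_
  rw [log_mono hu, mul_sub, mul_sum, mul_sum]
  congr 1
  exact sum_congr rfl fun j _ => by ring

lemma varEntropy_le_varPart (hV : ∀ j, 0 < D.avgVar j) {σ : (Fin 2 → ℕ) → ℝ}
    (hσ : ∀ l, 0 ≤ σ l ∧ σ l ≤ 1) {u : Fin 2 → ℝ} (hu : ∀ j, 0 < u j) :
    D.varEntropy σ ≤ D.varPart (D.edgeFrac σ) u := by
  rw [varPart_edgeFrac hV σ hu]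
  refine sum_le_sum fun l _ => mul_le_mul_of_nonneg_left ?_ (D.Λ_nonneg l)
  linarith [binEntropy_add_mul_log_le (hσ l).1 (hσ l).2 (mono_pos hu l)]

lemma varPart_tilt (hV : ∀ j, 0 < D.avgVar j) {u : Fin 2 → ℝ} (hu : ∀ j, 0 < u j) :
    D.varPart (D.edgeFrac (tilt u)) u = D.varEntropy (tilt u) := by
  rw [varPart_edgeFrac hV _ hu]
  refine sum_congr rfl fun l _ => ?_
  rw [← binEntropy_add_mul_log_eq (mono_pos hu l), tilt]
  ring

lemma checkPart_sub_checkEntropy (hC : 0 < D.avgCheck j) {p : ℕ → ℕ → ℝ} {e : ℝ}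
    (he : ∑ r ∈ (D.Γ j).support, D.Γ j r * meanWeight r (p r) = D.avgCheck j * e) (v : ℝ) :
    D.checkPart j e v - D.checkEntropy j p =
      D.avgVar j / D.avgCheck j * ∑ r ∈ (D.Γ j).support, D.Γ j r *
        (log (q r v) - (evenEntropy r (p r) + meanWeight r (p r) * log v)) := by
  have hedge : D.avgVar j * e * log v = D.avgVar j / D.avgCheck j *
      ∑ r ∈ (D.Γ j).support, D.Γ j r * (meanWeight r (p r) * log v) := by
    simp only [← mul_assoc]
    rw [← sum_mul, he]
    field_simp
  rw [checkPart, checkEntropy, hedge, sub_sub, ← mul_add, ← mul_sub, ← sum_add_distrib,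
    ← sum_sub_distrib]
  congr 1
  exact sum_congr rfl fun r _ => by ring

lemma checkEntropy_le_checkPart (hC : 0 < D.avgCheck j) {p : ℕ → ℕ → ℝ} {e v : ℝ}
    (hp : ∀ r, ∀ a ∈ range (r / 2 + 1), 0 ≤ p r a)
    (hsum : ∀ r, ∑ a ∈ range (r / 2 + 1), p r a = 1)
    (he : ∑ r ∈ (D.Γ j).support, D.Γ j r * meanWeight r (p r) = D.avgCheck j * e) (hv : 0 < v) :
    D.checkEntropy j p ≤ D.checkPart j e v := by
  rw [← sub_nonneg, checkPart_sub_checkEntropy hC he]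
  exact mul_nonneg (div_nonneg (D.avgVar_nonneg j) hC.le) (sum_nonneg fun r _ =>
    mul_nonneg (D.Γ_nonneg j r) (sub_nonneg.2 (evenEntropy_add_le_log_q (hp r) (hsum r) hv)))

lemma checkPart_eq_checkEntropy (hC : 0 < D.avgCheck j) {e v : ℝ}
    (he : ∑ r ∈ (D.Γ j).support, D.Γ j r * meanWeight r (checkTilt r v) = D.avgCheck j * e)
    (hv : 0 < v) :
    D.checkPart j e v = D.checkEntropy j fun r => checkTilt r v := by
  rw [← sub_eq_zero, checkPart_sub_checkEntropy hC he]
  simp [evenEntropy_checkTilt_add _ hv]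

lemma edgeFrac_tilt (u : Fin 2 → ℝ) (j : Fin 2) :
    D.edgeFrac (tilt u) j =
      1 / D.avgVar j * ∑ l ∈ D.Λ.support, D.Λ l * (l j : ℝ) * (mono u l / (1 + mono u l)) := by
  rw [edgeFrac, one_div, inv_mul_eq_div]
  congr 1
  exact sum_congr rfl fun l _ => by rw [tilt]; ring

lemma sum_meanWeight_checkTilt_div (j : Fin 2) (v : ℝ) :
    (∑ r ∈ (D.Γ j).support, D.Γ j r * meanWeight r (checkTilt r v)) / D.avgCheck j =
      v / D.avgCheck j * ∑ r ∈ (D.Γ j).support, (r : ℝ) * D.Γ j r *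
        (((1 + v) ^ (r - 1) - (1 - v) ^ (r - 1)) / ((1 + v) ^ r + (1 - v) ^ r)) := by
  rw [div_mul_eq_mul_div, mul_sum]
  congr 1
  exact sum_congr rfl fun r _ => by rw [meanWeight_checkTilt]; ring

namespace IsSaddlePoint

variable {e u v : Fin 2 → ℝ}

lemma eq_edgeFrac (h : D.IsSaddlePoint e u v) : e = D.edgeFrac (tilt u) := by
  ext j
  rw [← h.var_eq j, edgeFrac_tilt]

lemma sum_meanWeight_checkTilt (h : D.IsSaddlePoint e u v) (hC : 0 < D.avgCheck j) :
    ∑ r ∈ (D.Γ j).support, D.Γ j r * meanWeight r (checkTilt r (v j)) = D.avgCheck j * e j := by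
  rw [← h.check_eq j, ← sum_meanWeight_checkTilt_div, mul_div_cancel₀ _ hC.ne']

/-- By Gibbs' inequality, the entropy of the tilted types bounds `thetaExpr` from below at all
positive arguments, with equality at the saddle point. -/
lemma thetaExpr_le (h : D.IsSaddlePoint e u v) (hV : ∀ j, 0 < D.avgVar j)
    (hC : ∀ j, 0 < D.avgCheck j) {u' v' : Fin 2 → ℝ} (hu' : ∀ j, 0 < u' j)
    (hv' : ∀ j, 0 < v' j) : D.thetaExpr e u v ≤ D.thetaExpr e u' v' := by
  have hvarPart : D.varPart e u ≤ D.varPart e u' := by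
    rw [h.eq_edgeFrac, varPart_tilt hV h.u_pos]
    exact varEntropy_le_varPart hV
      (fun l => ⟨(tilt_pos h.u_pos l).le, (tilt_lt_one h.u_pos l).le⟩) hu'
  have hcheckPart : ∀ j, D.checkPart j (e j) (v j) ≤ D.checkPart j (e j) (v' j) := by
    intro j
    rw [checkPart_eq_checkEntropy (hC j) (h.sum_meanWeight_checkTilt (hC j)) (h.v_pos j)]
    exact checkEntropy_le_checkPart (hC j) (fun r a ha => (checkTilt_pos (h.v_pos j) ha).le)
      (fun r => sum_checkTilt r (h.v_pos j)) (h.sum_meanWeight_checkTilt (hC j)) (hv' j)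
  have hscaled : (D.thetaExpr e u v + D.designRate) * log 2 ≤
      (D.thetaExpr e u' v' + D.designRate) * log 2 := by
    rw [thetaExpr_add_designRate, thetaExpr_add_designRate]
    gcongr with j
    exact hcheckPart j
  linarith [le_of_mul_le_mul_right hscaled (log_pos one_lt_two)]

lemma typeExponent_tilt (h : D.IsSaddlePoint e u v) (hV : ∀ j, 0 < D.avgVar j) :
    D.typeExponent (tilt u) v = (D.thetaExpr e u v + D.designRate) * log 2 := by
  rw [typeExponent, thetaExpr_add_designRate, h.eq_edgeFrac, varPart_tilt hV h.u_pos]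

lemma typeExponent_le (h : D.IsSaddlePoint e u v) (hV : ∀ j, 0 < D.avgVar j)
    {σ : (Fin 2 → ℕ) → ℝ} (hσ : ∀ l, 0 ≤ σ l ∧ σ l ≤ 1) (he : D.edgeFrac σ = e) :
    D.typeExponent σ v ≤ (D.thetaExpr e u v + D.designRate) * log 2 := by
  rw [typeExponent, thetaExpr_add_designRate, ← he]
  gcongr
  exact varEntropy_le_varPart hV hσ h.u_pos

end IsSaddlePoint

lemma IsTheta.unique (hV : ∀ j, 0 < D.avgVar j) (hC : ∀ j, 0 < D.avgCheck j) {e : Fin 2 → ℝ}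
    {t t' : ℝ} (h : D.IsTheta e t) (h' : D.IsTheta e t') : t = t' := by
  obtain ⟨u, v, hs, rfl⟩ := h
  obtain ⟨u', v', hs', rfl⟩ := h'
  exact le_antisymm (hs.thetaExpr_le hV hC hs'.u_pos hs'.v_pos)
    (hs'.thetaExpr_le hV hC hs.u_pos hs.v_pos)

end DegreeDist

/-! ### Existence of saddle points -/

section Logistic

lemma mul_abs_le_log_one_add_exp_sub (σ x : ℝ) :
    min σ (1 - σ) * |x| ≤ log (1 + exp x) - σ * x := by
  have hx : x ≤ log (1 + exp x) := by
    rw [le_log_iff_exp_le (by positivity)]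
    linarith
  have h0 : 0 ≤ log (1 + exp x) := log_nonneg (by linarith [exp_pos x])
  rcases le_total 0 x with h | h
  · rw [abs_of_nonneg h]
    nlinarith [mul_le_mul_of_nonneg_right (min_le_right σ (1 - σ)) h]
  · rw [abs_of_nonpos h]
    nlinarith [mul_le_mul_of_nonneg_right (min_le_left σ (1 - σ)) (neg_nonneg.2 h)]

variable {ι : Type*} [Fintype ι]

/-- The loss function of logistic regression with weights `w` and responses `σ`. Its critical points
match the moments of `σ`. -/
def logisticLoss (w σ x : ι → ℝ) : ℝ := ∑ i, w i * (log (1 + exp (x i)) - σ i * x i)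

variable {w σ : ι → ℝ}

lemma continuous_logisticLoss : Continuous (logisticLoss w σ) := by
  unfold logisticLoss
  have hlog : ∀ i, Continuous fun x : ι → ℝ => log (1 + exp (x i)) := fun i =>
    Continuous.log (by fun_prop) fun x => by positivity
  fun_prop

lemma mul_abs_le_logisticLoss (hw : ∀ i, 0 ≤ w i) (hσ : ∀ i, 0 ≤ σ i ∧ σ i ≤ 1) (x : ι → ℝ)
    (i : ι) : w i * min (σ i) (1 - σ i) * |x i| ≤ logisticLoss w σ x := by
  have hterm : ∀ i, w i * min (σ i) (1 - σ i) * |x i| ≤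
      w i * (log (1 + exp (x i)) - σ i * x i) := fun i => by
    rw [mul_assoc]
    exact mul_le_mul_of_nonneg_left (mul_abs_le_log_one_add_exp_sub _ _) (hw i)
  have hnonneg : ∀ i, 0 ≤ w i * min (σ i) (1 - σ i) * |x i| := fun i =>
    mul_nonneg (mul_nonneg (hw i) (le_min (hσ i).1 (sub_nonneg.2 (hσ i).2))) (abs_nonneg _)
  exact (hterm i).trans (single_le_sum (f := fun i => w i * (log (1 + exp (x i)) - σ i * x i))
    (fun i _ => (hnonneg i).trans (hterm i)) (mem_univ i))

lemma exists_forall_logisticLoss_le (hw : ∀ i, 0 < w i) (hσ : ∀ i, 0 < σ i ∧ σ i < 1)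
    (V : Submodule ℝ (ι → ℝ)) :
    ∃ x ∈ V, ∀ y ∈ V, logisticLoss w σ x ≤ logisticLoss w σ y := by
  set L : ℝ := logisticLoss w σ 0
  have hslope : ∀ i, 0 < w i * min (σ i) (1 - σ i) := fun i =>
    mul_pos (hw i) (lt_min (hσ i).1 (sub_pos.2 (hσ i).2))
  have hbounded : Bornology.IsBounded {x : V | logisticLoss w σ x ≤ L} := by
    refine isBounded_iff_forall_norm_le.2
      ⟨∑ i, |L / (w i * min (σ i) (1 - σ i))|, fun x hx => ?_⟩
    rw [Submodule.coe_norm, pi_norm_le_iff_of_nonneg (sum_nonneg fun i _ => abs_nonneg _)]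
    intro i
    have hcoord : |x.1 i| ≤ L / (w i * min (σ i) (1 - σ i)) := by
      rw [le_div_iff₀' (hslope i)]
      exact (mul_abs_le_logisticLoss (fun i => (hw i).le)
        (fun i => ⟨(hσ i).1.le, (hσ i).2.le⟩) x i).trans hx
    exact hcoord.trans ((le_abs_self _).trans (single_le_sum
      (f := fun i => |L / (w i * min (σ i) (1 - σ i))|) (fun _ _ => abs_nonneg _) (mem_univ i)))
  obtain ⟨x, hx⟩ := (continuous_logisticLoss.comp
    continuous_subtype_val).exists_forall_le_of_isBounded (0 : V) hbounded
  exact ⟨x, x.2, fun y hy => hx ⟨y, hy⟩⟩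

lemma hasDerivAt_logisticLoss (w σ x y : ι → ℝ) :
    HasDerivAt (fun t : ℝ => logisticLoss w σ (x + t • y))
      (∑ i, w i * (exp (x i) / (1 + exp (x i)) - σ i) * y i) 0 := by
  have hsum : HasDerivAt (fun t : ℝ => logisticLoss w σ (x + t • y))
      (∑ i, w i * (exp (x i) * y i / (1 + exp (x i)) - σ i * y i)) 0 := by
    refine HasDerivAt.fun_sum fun i _ => HasDerivAt.const_mul _ ?_
    have hlin : HasDerivAt (fun t : ℝ => (x + t • y) i) (y i) 0 := by
      simpa using ((hasDerivAt_id (0 : ℝ)).mul_const (y i)).const_add (x i)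
    simpa using ((hlin.exp.const_add 1).log (by positivity)).fun_sub (hlin.const_mul (σ i))
  refine hsum.congr_deriv (sum_congr rfl fun i _ => by ring)

lemma exists_mem_forall_sum_logistic_eq (hw : ∀ i, 0 < w i) (hσ : ∀ i, 0 < σ i ∧ σ i < 1)
    (V : Submodule ℝ (ι → ℝ)) :
    ∃ x ∈ V, ∀ y ∈ V, ∑ i, w i * (exp (x i) / (1 + exp (x i))) * y i = ∑ i, w i * σ i * y i := by
  obtain ⟨x, hx, hmin⟩ := exists_forall_logisticLoss_le hw hσ V
  refine ⟨x, hx, fun y hy => ?_⟩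
  have hlocal : IsLocalMin (fun t : ℝ => logisticLoss w σ (x + t • y)) 0 :=
    Eventually.of_forall fun t => by simpa using hmin _ (V.add_mem hx (V.smul_mem t hy))
  rw [← sub_eq_zero, ← sum_sub_distrib,
    ← hlocal.hasDerivAt_eq_zero (hasDerivAt_logisticLoss w σ x y)]
  exact sum_congr rfl fun i _ => by ring

end Logistic

namespace DegreeDist

variable {D : DegreeDist} {j : Fin 2}

lemma exists_edgeFrac_tilt_eq {σ : (Fin 2 → ℕ) → ℝ} (hσ : ∀ l, 0 < σ l ∧ σ l < 1) :
    ∃ u : Fin 2 → ℝ, (∀ j, 0 < u j) ∧ D.edgeFrac (tilt u) = D.edgeFrac σ := by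
  set degree : Fin 2 → D.Λ.support → ℝ := fun j l => (l.1 j : ℝ)
  obtain ⟨x, hx, heq⟩ := exists_mem_forall_sum_logistic_eq (w := fun l : D.Λ.support => D.Λ l)
    (σ := fun l => σ l) (fun l => Λ_pos l.2) (fun l => hσ l)
    (Submodule.span ℝ (Set.range degree))
  obtain ⟨s, rfl⟩ := (Submodule.mem_span_range_iff_exists_fun ℝ).1 hx
  refine ⟨fun j => exp (s j), fun j => exp_pos _, ?_⟩
  have htilt : ∀ l : D.Λ.support, tilt (fun j => exp (s j)) l =
      exp ((∑ j, s j • degree j) l) / (1 + exp ((∑ j, s j • degree j) l)) := by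
    intro l
    have hmono : mono (fun j => exp (s j)) l = exp ((∑ j, s j • degree j) l) := by
      simp [mono, degree, exp_add, ← exp_nat_mul, mul_comm]
    rw [tilt, hmono]
  ext j
  rw [edgeFrac, edgeFrac, ← sum_coe_sort, ← sum_coe_sort D.Λ.support]
  congr 1
  simp only [htilt]
  convert heq (degree j) (Submodule.subset_span ⟨j, rfl⟩) using 2 <;> ring

/-- The largest possible average number of ones at a check node of type `j`. -/
def checkCap (D : DegreeDist) (j : Fin 2) : ℝ :=
  ∑ r ∈ (D.Γ j).support, D.Γ j r * ((2 * (r / 2) : ℕ) : ℝ)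

lemma checkCap_pos (h : ∃ r, 2 ≤ r ∧ 0 < D.Γ j r) : 0 < D.checkCap j := by
  obtain ⟨r, hr, hΓ⟩ := h
  exact sum_pos' (fun r _ => mul_nonneg (D.Γ_nonneg j r) (Nat.cast_nonneg _))
    ⟨r, Finsupp.mem_support_iff.2 hΓ.ne',
      mul_pos hΓ (mod_cast (by omega : 0 < 2 * (r / 2)))⟩

lemma mul_log_le_sum_log_q {A v : ℝ} (hA : 0 ≤ A) (hcap : A ≤ D.checkCap j) (hv : 0 < v) :
    A * log v ≤ ∑ r ∈ (D.Γ j).support, D.Γ j r * log (q r v) := by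
  rcases le_total (log v) 0 with hlog | hlog
  · exact (mul_nonpos_of_nonneg_of_nonpos hA hlog).trans
      (sum_nonneg fun r _ => mul_nonneg (D.Γ_nonneg j r) (log_q_nonneg r hv))
  · refine (mul_le_mul_of_nonneg_right hcap hlog).trans ?_
    rw [checkCap, sum_mul]
    refine sum_le_sum fun r _ => ?_
    rw [mul_assoc]
    exact mul_le_mul_of_nonneg_left (mul_log_le_log_q r hv) (D.Γ_nonneg j r)

lemma checkPart_nonneg (hC : 0 < D.avgCheck j) {e v : ℝ} (he : 0 ≤ e)
    (hcap : D.avgCheck j * e ≤ D.checkCap j) (hv : 0 < v) : 0 ≤ D.checkPart j e v := by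
  have hbound := mul_le_mul_of_nonneg_left (mul_log_le_sum_log_q (mul_nonneg hC.le he) hcap hv)
    (div_nonneg (D.avgVar_nonneg j) hC.le)
  have hcancel : D.avgVar j / D.avgCheck j * (D.avgCheck j * e * log v) =
      D.avgVar j * e * log v := by
    field_simp
  rw [checkPart]
  linarith

lemma exists_forall_sum_log_q_sub_le {A : ℝ} (hA : 0 < A) (hcap : A < D.checkCap j) :
    ∃ v > 0, ∀ v' > 0, ∑ r ∈ (D.Γ j).support, D.Γ j r * log (q r v) - A * log v ≤
      ∑ r ∈ (D.Γ j).support, D.Γ j r * log (q r v') - A * log v' := by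
  set F : ℝ → ℝ := fun y => ∑ r ∈ (D.Γ j).support, D.Γ j r * log (q r (exp y)) - A * y with hF
  have hcont : Continuous F := by
    have hq : ∀ r, Continuous fun y => log (q r (exp y)) := fun r =>
      Continuous.log (by unfold q; fun_prop) fun y => (q_pos r (exp_pos y)).ne'
    fun_prop
  have hlow : ∀ y, -(A * y) ≤ F y := fun y => by
    have := mul_log_le_sum_log_q le_rfl (hA.le.trans hcap.le) (exp_pos y)
    simp only [hF]
    linarith
  have hhigh : ∀ y, (D.checkCap j - A) * y ≤ F y := fun y => by
    have := mul_log_le_sum_log_q (hA.le.trans hcap.le) le_rfl (exp_pos y)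
    rw [log_exp] at this
    simp only [hF]
    linarith
  have hbounded : Bornology.IsBounded {y | F y ≤ F 0} := by
    refine (Metric.isBounded_Icc (-(F 0 / A)) (F 0 / (D.checkCap j - A))).subset fun y hy => ?_
    have hy : F y ≤ F 0 := hy
    constructor
    · rw [neg_le, le_div_iff₀' hA]
      linarith [hlow y]
    · rw [le_div_iff₀' (sub_pos.2 hcap)]
      exact (hhigh y).trans hy
  obtain ⟨y, hy⟩ := hcont.exists_forall_le_of_isBounded 0 hbounded
  refine ⟨exp y, exp_pos y, fun v' hv' => ?_⟩
  simpa only [hF, log_exp, exp_log hv'] using hy (log v')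

lemma exists_sum_meanWeight_checkTilt_eq {A : ℝ} (hA : 0 < A) (hcap : A < D.checkCap j) :
    ∃ v > 0, ∑ r ∈ (D.Γ j).support, D.Γ j r * meanWeight r (checkTilt r v) = A := by
  obtain ⟨v, hv, hmin⟩ := exists_forall_sum_log_q_sub_le hA hcap
  refine ⟨v, hv, ?_⟩
  have hderiv : HasDerivAt
      (fun x => ∑ r ∈ (D.Γ j).support, D.Γ j r * log (q r x) - A * log x)
      (∑ r ∈ (D.Γ j).support, D.Γ j r *
        (r * ((1 + v) ^ (r - 1) - (1 - v) ^ (r - 1)) / 2 / q r v) - A * v⁻¹) v :=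
    (HasDerivAt.fun_sum fun r _ => ((hasDerivAt_q r v).log (q_pos r hv).ne').const_mul _).sub
      ((hasDerivAt_log hv.ne').const_mul A)
  have hlocal : IsLocalMin
      (fun x => ∑ r ∈ (D.Γ j).support, D.Γ j r * log (q r x) - A * log x) v := by
    filter_upwards [lt_mem_nhds hv] with x hx using hmin x hx
  have hzero := hlocal.hasDerivAt_eq_zero hderiv
  have hscaled : ∑ r ∈ (D.Γ j).support, D.Γ j r * meanWeight r (checkTilt r v) - A =
      v * (∑ r ∈ (D.Γ j).support, D.Γ j r *
        (r * ((1 + v) ^ (r - 1) - (1 - v) ^ (r - 1)) / 2 / q r v) - A * v⁻¹) := by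
    rw [mul_sub, mul_left_comm v A, mul_inv_cancel₀ hv.ne', mul_one, mul_sum]
    congr 1
    refine sum_congr rfl fun r _ => ?_
    rw [meanWeight_checkTilt, q, ← mul_div_assoc (r : ℝ), div_div_div_cancel_right₀ two_ne_zero]
    ring
  rwa [hzero, mul_zero, sub_eq_zero] at hscaled

lemma edgeFrac_pos (hV : 0 < D.avgVar j) {σ : (Fin 2 → ℕ) → ℝ} (hσ : ∀ l, 0 < σ l) :
    0 < D.edgeFrac σ j := by
  obtain ⟨l, hl, hpos⟩ := exists_lt_of_sum_lt (show
    ∑ _l ∈ D.Λ.support, (0 : ℝ) < ∑ l ∈ D.Λ.support, (l j : ℝ) * D.Λ l by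
      simpa [avgVar] using hV)
  exact div_pos (sum_pos'
    (fun l _ => mul_nonneg (mul_nonneg (Nat.cast_nonneg _) (D.Λ_nonneg l)) (hσ l).le)
    ⟨l, hl, mul_pos hpos (hσ l)⟩) hV

lemma edgeFrac_mem_Icc (hV : 0 < D.avgVar j) {σ : (Fin 2 → ℕ) → ℝ}
    (hσ : ∀ l, 0 ≤ σ l ∧ σ l ≤ 1) : D.edgeFrac σ j ∈ Set.Icc (0 : ℝ) 1 := by
  have hweight : ∀ l : Fin 2 → ℕ, 0 ≤ (l j : ℝ) * D.Λ l := fun l =>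
    mul_nonneg (Nat.cast_nonneg _) (D.Λ_nonneg l)
  refine ⟨div_nonneg (sum_nonneg fun l _ => mul_nonneg (hweight l) (hσ l).1) hV.le, ?_⟩
  rw [edgeFrac, div_le_one hV]
  exact sum_le_sum fun l _ => mul_le_of_le_one_right (hweight l) (hσ l).2

lemma edgeFrac_const (hV : 0 < D.avgVar j) (c : ℝ) : D.edgeFrac (fun _ => c) j = c := by
  rw [edgeFrac, ← sum_mul]
  exact mul_div_cancel_left₀ _ hV.ne'

lemma edgeFrac_convexComb (hV : 0 < D.avgVar j) (σ : (Fin 2 → ℕ) → ℝ) (c t : ℝ) :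
    D.edgeFrac (fun l => (1 - t) * σ l + t * c) j = (1 - t) * D.edgeFrac σ j + t * c := by
  nth_rw 2 [← edgeFrac_const hV c]
  simp only [edgeFrac]
  rw [← mul_div_assoc, ← mul_div_assoc, ← add_div, mul_sum, mul_sum, ← sum_add_distrib]
  congr 1
  exact sum_congr rfl fun l _ => by ring

lemma edgeFrac_mem_region {σ : (Fin 2 → ℕ) → ℝ} (hσ : ∀ l, 0 ≤ σ l ∧ σ l ≤ 1) :
    D.edgeFrac σ ∈ D.region := ⟨σ, hσ, fun _ => rfl⟩

lemma exists_isSaddlePoint (hV : ∀ j, 0 < D.avgVar j) (hC : ∀ j, 0 < D.avgCheck j)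
    {σ : (Fin 2 → ℕ) → ℝ} (hσ : ∀ l, 0 < σ l ∧ σ l < 1)
    (hcap : ∀ j, D.avgCheck j * D.edgeFrac σ j < D.checkCap j) :
    ∃ u v, D.IsSaddlePoint (D.edgeFrac σ) u v := by
  obtain ⟨u, hu, hvar⟩ := exists_edgeFrac_tilt_eq (D := D) hσ
  choose v hv hcheck using fun j => exists_sum_meanWeight_checkTilt_eq
    (mul_pos (hC j) (edgeFrac_pos (hV j) fun l => (hσ l).1)) (hcap j)
  refine ⟨u, v, hu, hv, fun j => ?_, fun j => ?_⟩
  · rw [← sum_meanWeight_checkTilt_div, hcheck, mul_div_cancel_left₀ _ (hC j).ne']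
  · rw [← edgeFrac_tilt, hvar]

lemma exists_const_lt_checkCap (hcap : ∀ j, 0 < D.checkCap j) :
    ∃ c : ℝ, 0 < c ∧ c < 1 ∧ ∀ j, D.avgCheck j * c < D.checkCap j := by
  have hsmall : ∀ᶠ c : ℝ in 𝓝[>] 0, ∀ j, D.avgCheck j * c < D.checkCap j :=
    eventually_all.2 fun j => ((continuous_const.mul continuous_id).tendsto' 0 0
      (mul_zero _)).eventually_lt_const (hcap j) |>.filter_mono nhdsWithin_le_nhds
  obtain ⟨c, hc, hc01⟩ := (hsmall.and (Ioo_mem_nhdsGT one_pos)).exists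
  exact ⟨c, hc01.1, hc01.2, hc⟩

lemma isTheta_nonempty (hV : ∀ j, 0 < D.avgVar j) (hC : ∀ j, 0 < D.avgCheck j)
    (hcap : ∀ j, 0 < D.checkCap j) : {t | ∃ e ∈ D.region, D.IsTheta e t}.Nonempty := by
  obtain ⟨c, hc0, hc1, hc⟩ := exists_const_lt_checkCap hcap
  obtain ⟨u, v, h⟩ := exists_isSaddlePoint hV hC (σ := fun _ => c) (fun _ => ⟨hc0, hc1⟩)
    (fun j => (edgeFrac_const (hV j) c).symm ▸ hc j)
  exact ⟨_, _, edgeFrac_mem_region fun _ => ⟨hc0.le, hc1.le⟩, u, v, h, rfl⟩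

lemma isTheta_bddAbove (hV : ∀ j, 0 < D.avgVar j) (hC : ∀ j, 0 < D.avgCheck j) :
    BddAbove {t | ∃ e ∈ D.region, D.IsTheta e t} := by
  refine ⟨(D.varPart 0 1 + ∑ j, D.checkPart j 0 1) / log 2 - D.designRate, ?_⟩
  rintro t ⟨e, -, u, v, h, rfl⟩
  refine (h.thetaExpr_le hV hC (u' := 1) (v' := 1) (fun _ => one_pos) fun _ => one_pos).trans ?_
  rw [le_sub_iff_add_le, le_div_iff₀ (log_pos one_lt_two), thetaExpr_add_designRate]
  have hvar : D.varPart e 1 = D.varPart 0 1 := by simp [varPart]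
  have hcheck : ∀ j, D.checkPart j (e j) 1 = D.checkPart j 0 1 := fun j => by simp [checkPart]
  rw [hvar]
  gcongr with j
  rw [Pi.one_apply, hcheck, sub_le_self_iff, h.eq_edgeFrac]
  have he := edgeFrac_mem_Icc (hV j)
    fun l => ⟨(tilt_pos h.u_pos l).le, (tilt_lt_one h.u_pos l).le⟩
  exact mul_nonneg (hV j).le (binEntropy_nonneg he.1 he.2)

lemma exists_typeExponent_le (hV : ∀ j, 0 < D.avgVar j) (hC : ∀ j, 0 < D.avgCheck j) {S : ℝ}
    (hS : S ∈ upperBounds {t | ∃ e ∈ D.region, D.IsTheta e t})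
    {σ : (Fin 2 → ℕ) → ℝ} (hσ : ∀ l, 0 < σ l ∧ σ l < 1)
    (hcap : ∀ j, D.avgCheck j * D.edgeFrac σ j < D.checkCap j) :
    ∃ v : Fin 2 → ℝ, (∀ j, 0 < v j) ∧ D.typeExponent σ v ≤ (S + D.designRate) * log 2 := by
  obtain ⟨u, v, h⟩ := exists_isSaddlePoint hV hC hσ hcap
  have hσ' : ∀ l, 0 ≤ σ l ∧ σ l ≤ 1 := fun l => ⟨(hσ l).1.le, (hσ l).2.le⟩
  have hθ : D.thetaExpr (D.edgeFrac σ) u v ≤ S := hS ⟨_, edgeFrac_mem_region hσ', u, v, h, rfl⟩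
  refine ⟨v, h.v_pos, (h.typeExponent_le hV hσ' rfl).trans ?_⟩
  have := log_pos one_lt_two
  gcongr

/-- The part of `typeExponent` that is not affine in the type. -/
def varExponent (D : DegreeDist) (σ : (Fin 2 → ℕ) → ℝ) : ℝ :=
  D.varEntropy σ - ∑ j, D.avgVar j * binEntropy (D.edgeFrac σ j)

lemma continuous_varExponent : Continuous D.varExponent := by
  have hedge : ∀ j, Continuous fun σ => D.edgeFrac σ j := fun j => by unfold edgeFrac; fun_prop
  have := binEntropy_continuous
  unfold varExponent varEntropy
  fun_prop

lemma typeExponent_eq_varExponent_add (σ : (Fin 2 → ℕ) → ℝ) (v : Fin 2 → ℝ) :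
    D.typeExponent σ v = D.varExponent σ + ∑ j, D.checkPart j (D.edgeFrac σ j) (v j) := by
  rw [typeExponent, varExponent, sum_sub_distrib]
  ring

lemma typeExponent_convexComb (hV : ∀ j, 0 < D.avgVar j) (σ : (Fin 2 → ℕ) → ℝ) (c t : ℝ)
    (v : Fin 2 → ℝ) :
    D.typeExponent (fun l => (1 - t) * σ l + t * c) v =
      (1 - t) * (D.typeExponent σ v - D.varExponent σ) + t * ∑ j, D.checkPart j c (v j) +
        D.varExponent (fun l => (1 - t) * σ l + t * c) := by
  have hcheck : ∀ j, D.checkPart j ((1 - t) * D.edgeFrac σ j + t * c) (v j) =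
      (1 - t) * D.checkPart j (D.edgeFrac σ j) (v j) + t * D.checkPart j c (v j) := fun j => by
    simp only [checkPart]
    ring
  simp only [typeExponent_eq_varExponent_add, edgeFrac_convexComb (hV _), hcheck, sum_add_distrib,
    ← mul_sum]
  ring

/-- A type on the boundary may have no saddle point, so it is moved towards the type with a small
constant fraction `c`; there `checkPart` is nonnegative, whatever the value of `v` is. -/
lemma le_of_forall_le_typeExponent (hV : ∀ j, 0 < D.avgVar j) (hC : ∀ j, 0 < D.avgCheck j)
    (hcap : ∀ j, 0 < D.checkCap j) {S : ℝ}
    (hS : S ∈ upperBounds {t | ∃ e ∈ D.region, D.IsTheta e t})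
    {σ : (Fin 2 → ℕ) → ℝ} (hσ : ∀ l, 0 ≤ σ l ∧ σ l ≤ 1)
    (hσcap : ∀ j, D.avgCheck j * D.edgeFrac σ j ≤ D.checkCap j) {x : ℝ}
    (hx : ∀ v : Fin 2 → ℝ, (∀ j, 0 < v j) → x ≤ D.typeExponent σ v) :
    x ≤ (S + D.designRate) * log 2 := by
  obtain ⟨c, hc0, hc1, hc⟩ := exists_const_lt_checkCap hcap
  set σt : ℝ → (Fin 2 → ℕ) → ℝ := fun t l => (1 - t) * σ l + t * c with hσt
  set f : ℝ → ℝ := fun t => (1 - t) * (x - D.varExponent σ) + D.varExponent (σt t) with hf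
  have hlim : Tendsto f (𝓝[>] 0) (𝓝 x) := by
    have hpath : Continuous σt := by fun_prop
    have hcont : Continuous f := by
      have := (continuous_varExponent (D := D)).comp hpath
      fun_prop
    have hf0 : f 0 = x := by simp [hf, hσt]
    exact hf0 ▸ (hcont.tendsto 0).mono_left nhdsWithin_le_nhds
  refine le_of_tendsto hlim ?_
  filter_upwards [Ioo_mem_nhdsGT (zero_lt_one (α := ℝ))] with t ⟨ht0, ht1⟩
  have h1t : 0 < 1 - t := sub_pos.2 ht1
  have hinterior : ∀ l, 0 < σt t l ∧ σt t l < 1 := fun l =>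
    ⟨by nlinarith [mul_nonneg h1t.le (hσ l).1, mul_pos ht0 hc0],
      by nlinarith [mul_le_mul_of_nonneg_left (hσ l).2 h1t.le, mul_lt_mul_of_pos_left hc1 ht0]⟩
  obtain ⟨v, hv, hle⟩ := exists_typeExponent_le hV hC hS hinterior fun j => by
    rw [edgeFrac_convexComb (hV j)]
    nlinarith [mul_le_mul_of_nonneg_left (hσcap j) h1t.le, mul_lt_mul_of_pos_left (hc j) ht0]
  have hcheck : 0 ≤ ∑ j, D.checkPart j c (v j) :=
    sum_nonneg fun j _ => checkPart_nonneg (hC j) hc0.le (hc j).le (hv j)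
  calc f t ≤ (1 - t) * (D.typeExponent σ v - D.varExponent σ) +
        t * ∑ j, D.checkPart j c (v j) + D.varExponent (σt t) := by
        have := mul_nonneg ht0.le hcheck
        have := mul_le_mul_of_nonneg_left (sub_le_sub_right (hx v hv) (D.varExponent σ)) h1t.le
        simp only [hf]
        linarith
    _ = D.typeExponent (σt t) v := (typeExponent_convexComb hV σ c t v).symm
    _ ≤ _ := hle

end DegreeDist

/-! ### Asymptotics of multinomial coefficients -/

lemma log_factorial_le (n : ℕ) : log n.factorial ≤ n * log n - n + log (n + 1) + 1 := by
  rcases n with _ | n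
  · simp
  have hn : (0 : ℝ) < ((n + 1 : ℕ) : ℝ) := by positivity
  have hformula := Stirling.log_stirlingSeq_formula (n + 1)
  have hantitone : log (Stirling.stirlingSeq (n + 1)) ≤ log (Stirling.stirlingSeq 1) :=
    Stirling.log_stirlingSeq'_antitone (Nat.zero_le n)
  rw [Stirling.stirlingSeq_one, log_div (exp_pos 1).ne' (by positivity), log_exp,
    log_sqrt zero_le_two] at hantitone
  rw [log_mul two_ne_zero hn.ne', log_div hn.ne' (exp_pos 1).ne', log_exp] at hformula
  have hsucc : log ((n + 1 : ℕ) : ℝ) ≤ log (((n + 1 : ℕ) : ℝ) + 1) := log_le_log hn (by linarith)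
  have hnonneg : 0 ≤ log ((n + 1 : ℕ) : ℝ) := log_natCast_nonneg _
  linarith

lemma le_log_factorial (n : ℕ) : n * log n - n ≤ log n.factorial := by
  rcases n.eq_zero_or_pos with rfl | hn
  · simp
  have hstirling := Stirling.le_log_factorial_stirling hn.ne'
  have hlog : 0 ≤ log (n : ℝ) := log_natCast_nonneg _
  have htwo_pi : 0 ≤ log (2 * π) := log_nonneg (by linarith [pi_gt_three])
  linarith

section Asymptotics

variable {ι κ : Type*} {F : Filter ι} {N : ι → ℕ}

lemma tendsto_inv_natCast (hN : Tendsto N F atTop) :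
    Tendsto (fun i => (N i : ℝ)⁻¹) F (𝓝 0) :=
  tendsto_inv_atTop_zero.comp (tendsto_natCast_atTop_atTop.comp hN)

lemma eventually_le_of_tendsto_div {a b : ι → ℕ} {α β : ℝ}
    (ha : Tendsto (fun i => (a i : ℝ) / N i) F (𝓝 α))
    (hb : Tendsto (fun i => (b i : ℝ) / N i) F (𝓝 β)) (h : α < β) : ∀ᶠ i in F, a i ≤ b i := by
  filter_upwards [ha.eventually_lt hb h] with i hi
  by_contra! hba
  exact hi.not_ge (div_le_div_of_nonneg_right (mod_cast hba.le) (Nat.cast_nonneg _))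

lemma tendsto_log_add_one_div (hN : Tendsto N F atTop) {a : ι → ℕ} {α : ℝ}
    (ha : Tendsto (fun i => (a i : ℝ) / N i) F (𝓝 α)) :
    Tendsto (fun i => log (a i + 1) / N i) F (𝓝 0) := by
  have hinv := tendsto_inv_natCast hN
  have hbound :
      Tendsto (fun i => 2 * √(((a i : ℝ) / N i + (N i : ℝ)⁻¹) * (N i : ℝ)⁻¹)) F (𝓝 0) := by
    simpa using (((ha.add hinv).mul hinv).sqrt).const_mul 2
  refine squeeze_zero (fun i => div_nonneg (log_nonneg (by
    linarith [Nat.cast_nonneg (α := ℝ) (a i)])) (Nat.cast_nonneg _)) (fun i => ?_) hbound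
  have hpos : (0 : ℝ) < a i + 1 := by positivity
  have hsq : ((a i : ℝ) / N i + (N i : ℝ)⁻¹) * (N i : ℝ)⁻¹ = (a i + 1) / (N i) ^ 2 := by ring
  have hlog : log (a i + 1) = 2 * log √(a i + 1) := by
    rw [log_sqrt hpos.le]
    ring
  rw [hsq, sqrt_div hpos.le, sqrt_sq (Nat.cast_nonneg _), ← mul_div_assoc, hlog]
  gcongr
  exact log_le_self (sqrt_nonneg _)

lemma tendsto_log_factorial (hN : Tendsto N F atTop) {a : ι → ℕ} {α : ℝ}
    (ha : Tendsto (fun i => (a i : ℝ) / N i) F (𝓝 α)) :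
    Tendsto (fun i => (log (a i).factorial - a i * log (N i) + a i) / N i) F
      (𝓝 (-negMulLog α)) := by
  have hlow : Tendsto (fun i => -negMulLog ((a i : ℝ) / N i)) F (𝓝 (-negMulLog α)) :=
    ((continuous_negMulLog.tendsto α).comp ha).neg
  have hhigh : Tendsto (fun i => -negMulLog ((a i : ℝ) / N i) +
      (log (a i + 1) / N i + (N i : ℝ)⁻¹)) F (𝓝 (-negMulLog α)) := by
    simpa using hlow.add ((tendsto_log_add_one_div hN ha).add (tendsto_inv_natCast hN))
  have hnegMulLog : ∀ᶠ i in F,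
      -negMulLog ((a i : ℝ) / N i) = (a i * log (a i) - a i * log (N i)) / N i := by
    filter_upwards [hN.eventually_gt_atTop 0] with i hi
    rcases (a i).eq_zero_or_pos with h | h
    · simp [h]
    · rw [negMulLog, log_div (by positivity) (by positivity)]
      ring
  refine tendsto_of_tendsto_of_tendsto_of_le_of_le' hlow hhigh ?_ ?_
  · filter_upwards [hnegMulLog] with i hi
    rw [hi]
    exact div_le_div_of_nonneg_right (by linarith [le_log_factorial (a i)]) (Nat.cast_nonneg _)
  · filter_upwards [hnegMulLog] with i hi
    rw [hi, ← one_div, ← add_div, ← add_div]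
    exact div_le_div_of_nonneg_right (by linarith [log_factorial_le (a i)]) (Nat.cast_nonneg _)

lemma tendsto_natCast_sub_div {a b : ι → ℕ} {α β : ℝ}
    (ha : Tendsto (fun i => (a i : ℝ) / N i) F (𝓝 α))
    (hb : Tendsto (fun i => (b i : ℝ) / N i) F (𝓝 β)) (hba : ∀ᶠ i in F, b i ≤ a i) :
    Tendsto (fun i => ((a i - b i : ℕ) : ℝ) / N i) F (𝓝 (α - β)) :=
  (ha.sub hb).congr' <| hba.mono fun i hi => by simp only [Nat.cast_sub hi, sub_div]

lemma tendsto_natCast_sum_mul_div {s : Finset κ} {d : κ → ℕ} {t : ι → κ → ℕ} {τ : κ → ℝ}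
    (ht : ∀ a ∈ s, Tendsto (fun i => (t i a : ℝ) / N i) F (𝓝 (τ a))) :
    Tendsto (fun i => ((∑ a ∈ s, d a * t i a : ℕ) : ℝ) / N i) F (𝓝 (∑ a ∈ s, d a * τ a)) := by
  refine (tendsto_finsetSum s fun a ha => (ht a ha).const_mul (d a : ℝ)).congr fun i => ?_
  simp only [Nat.cast_sum, Nat.cast_mul, sum_div, mul_div_assoc]

lemma tendsto_log_choose (hN : Tendsto N F atTop) {a b : ι → ℕ} {α s : ℝ}
    (ha : Tendsto (fun i => (a i : ℝ) / N i) F (𝓝 α))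
    (hb : Tendsto (fun i => (b i : ℝ) / N i) F (𝓝 (α * s))) (hba : ∀ i, b i ≤ a i) :
    Tendsto (fun i => log ((a i).choose (b i)) / N i) F (𝓝 (α * binEntropy s)) := by
  have hlim : -negMulLog α - -negMulLog (α * s) - -negMulLog (α - α * s) = α * binEntropy s := by
    rw [← mul_one_sub, negMulLog_mul, negMulLog_mul,
      binEntropy_eq_negMulLog_add_negMulLog_one_sub]
    ring
  rw [← hlim]
  refine (((tendsto_log_factorial hN ha).sub (tendsto_log_factorial hN hb)).sub
    (tendsto_log_factorial hN (tendsto_natCast_sub_div ha hb (.of_forall hba)))).congr fun i => ?_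
  rw [Nat.cast_choose ℝ (hba i), log_div (by positivity) (by positivity),
    log_mul (by positivity) (by positivity), Nat.cast_sub (hba i)]
  ring

lemma log_multinomial (s : Finset κ) (t : κ → ℕ) :
    log (Nat.multinomial s t) =
      log (∑ a ∈ s, t a).factorial - ∑ a ∈ s, log (t a).factorial := by
  have hmult : (Nat.multinomial s t : ℝ) ≠ 0 := mod_cast (Nat.multinomial_pos s t).ne'
  rw [← Nat.multinomial_spec s t, Nat.cast_mul, Nat.cast_prod,
    log_mul (prod_ne_zero_iff.2 fun a _ => by positivity) hmult,
    log_prod fun a _ => by positivity]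
  ring

lemma tendsto_log_multinomial (hN : Tendsto N F atTop) (s : Finset κ) {t : ι → κ → ℕ} {μ : ℝ}
    {p : κ → ℝ} (hp : ∑ a ∈ s, p a = 1)
    (ht : ∀ a ∈ s, Tendsto (fun i => (t i a : ℝ) / N i) F (𝓝 (μ * p a))) :
    Tendsto (fun i => log (Nat.multinomial s (t i)) / N i) F
      (𝓝 (μ * ∑ a ∈ s, negMulLog (p a))) := by
  have htotal : Tendsto (fun i => ((∑ a ∈ s, t i a : ℕ) : ℝ) / N i) F (𝓝 μ) := by
    have hsum := tendsto_natCast_sum_mul_div (d := fun _ => 1) ht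
    simpa only [one_mul, Nat.cast_one, ← mul_sum, hp, mul_one] using hsum
  have hlim : -negMulLog μ - ∑ a ∈ s, -negMulLog (μ * p a) = μ * ∑ a ∈ s, negMulLog (p a) := by
    simp only [negMulLog_mul, neg_add, sum_add_distrib, sum_neg_distrib, ← sum_mul, hp, ← mul_sum]
    ring
  rw [← hlim]
  refine ((tendsto_log_factorial hN htotal).sub
    (tendsto_finsetSum s fun a ha => tendsto_log_factorial hN (ht a ha))).congr fun i => ?_
  rw [log_multinomial, ← sum_div, ← sub_div, sum_add_distrib, sum_sub_distrib, ← sum_mul,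
    Nat.cast_sum]
  ring

lemma tendsto_floor_div (hN : Tendsto N F atTop) {x : ι → ℝ} {ξ : ℝ} (hx0 : ∀ i, 0 ≤ x i)
    (hx : Tendsto (fun i => x i / N i) F (𝓝 ξ)) :
    Tendsto (fun i => (⌊x i⌋₊ : ℝ) / N i) F (𝓝 ξ) := by
  have hlow : Tendsto (fun i => x i / N i - (N i : ℝ)⁻¹) F (𝓝 ξ) := by
    simpa using hx.sub (tendsto_inv_natCast hN)
  refine tendsto_of_tendsto_of_tendsto_of_le_of_le hlow hx (fun i => ?_) fun i => ?_
  · simp only [← one_div, ← sub_div]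
    gcongr
    linarith [Nat.lt_floor_add_one (x i)]
  · dsimp only
    gcongr
    exact Nat.floor_le (hx0 i)

lemma exists_even_le_tendsto_div (hN : Tendsto N F atTop) {m : ι → κ → ℕ} {μ σ : κ → ℝ}
    (hm : ∀ a, Tendsto (fun i => (m i a : ℝ) / N i) F (𝓝 (μ a))) (hσ : ∀ a, 0 ≤ σ a ∧ σ a ≤ 1) :
    ∃ k : ι → κ → ℕ, (∀ i a, Even (k i a)) ∧ (∀ i a, k i a ≤ m i a) ∧
      ∀ a, Tendsto (fun i => (k i a : ℝ) / N i) F (𝓝 (μ a * σ a)) := by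
  have hnonneg : ∀ i a, 0 ≤ m i a * σ a / 2 := fun i a =>
    div_nonneg (mul_nonneg (Nat.cast_nonneg _) (hσ a).1) zero_le_two
  refine ⟨fun i a => 2 * ⌊m i a * σ a / 2⌋₊, fun i a => even_two_mul _, fun i a => ?_, fun a => ?_⟩
  · have hfloor := Nat.floor_le (hnonneg i a)
    have hle := mul_le_of_le_one_right (Nat.cast_nonneg (α := ℝ) (m i a)) (hσ a).2
    rw [← Nat.cast_le (α := ℝ), Nat.cast_mul, Nat.cast_two]
    linarith
  · have hhalf : Tendsto (fun i => m i a * σ a / 2 / N i) F (𝓝 (μ a * σ a / 2)) :=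
      (((hm a).mul_const (σ a)).div_const 2).congr fun i => by ring
    have hdouble := (tendsto_floor_div hN (fun i => hnonneg i a) hhalf).const_mul 2
    rw [mul_div_cancel₀ _ two_ne_zero] at hdouble
    simpa only [Nat.cast_mul, Nat.cast_two, mul_div_assoc] using hdouble

lemma exists_sum_mul_eq_of_tendsto {S : Finset κ} {d : κ → ℕ} {c₀ : κ}
    (hc₀ : c₀ ∈ S) (hd : d c₀ ≠ 0) (hdvd : ∀ c ∈ S, d c₀ ∣ d c) {x : ι → κ → ℕ} {ξ : κ → ℝ}
    (hx : ∀ c ∈ S, c ≠ c₀ → Tendsto (fun i => (x i c : ℝ) / N i) F (𝓝 (ξ c))) (hξ : 0 < ξ c₀)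
    {M : ι → ℕ} (hM : ∀ i, d c₀ ∣ M i)
    (hMlim : Tendsto (fun i => (M i : ℝ) / N i) F (𝓝 (∑ c ∈ S, d c * ξ c))) :
    ∃ t : ι → κ → ℕ, (∀ i, ∀ c ≠ c₀, t i c = x i c) ∧
      (∀ c ∈ S, Tendsto (fun i => (t i c : ℝ) / N i) F (𝓝 (ξ c))) ∧
      ∀ᶠ i in F, ∑ c ∈ S, d c * t i c = M i := by
  classical
  set R : ι → ℕ := fun i => ∑ c ∈ S.erase c₀, d c * x i c
  have hRlim : Tendsto (fun i => (R i : ℝ) / N i) F (𝓝 (∑ c ∈ S.erase c₀, d c * ξ c)) :=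
    tendsto_natCast_sum_mul_div fun c hc => hx c (mem_of_mem_erase hc) (ne_of_mem_erase hc)
  have hRdvd : ∀ i, d c₀ ∣ R i := fun i =>
    dvd_sum fun c hc => (hdvd c (mem_of_mem_erase hc)).mul_right _
  have hd' : (d c₀ : ℝ) ≠ 0 := mod_cast hd
  have hRM : ∀ᶠ i in F, R i ≤ M i := by
    refine eventually_le_of_tendsto_div hRlim hMlim ?_
    rw [← add_sum_erase S _ hc₀]
    exact lt_add_of_pos_left _ (by positivity)
  refine ⟨fun i => Function.update (x i) c₀ ((M i - R i) / d c₀),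
    fun i c hc => Function.update_of_ne hc _ _, fun c hc => ?_, ?_⟩
  · rcases eq_or_ne c c₀ with rfl | hne
    · have hsub := (tendsto_natCast_sub_div hMlim hRlim hRM).div_const (d c : ℝ)
      rw [← add_sum_erase S _ hc₀, add_sub_cancel_right, mul_div_cancel_left₀ _ hd'] at hsub
      refine hsub.congr fun i => ?_
      dsimp only
      rw [Function.update_self, Nat.cast_div (Nat.dvd_sub (hM i) (hRdvd i)) hd', div_right_comm]
    · simpa only [Function.update_of_ne hne] using hx c hc hne
  · filter_upwards [hRM] with i hi
    have hsum : ∑ c ∈ S.erase c₀, d c * Function.update (x i) c₀ ((M i - R i) / d c₀) c = R i :=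
      sum_congr rfl fun c hc => by rw [Function.update_of_ne (ne_of_mem_erase hc)]
    rw [← add_sum_erase S _ hc₀, hsum, Function.update_self,
      Nat.mul_div_cancel' (Nat.dvd_sub (hM i) (hRdvd i)), Nat.sub_add_cancel hi]

lemma exists_tendsto_div_of_le {U : Ultrafilter ι} {k m : ι → κ → ℕ}
    {μ : κ → ℝ} (hk : ∀ i a, k i a ≤ m i a)
    (hm : ∀ a, Tendsto (fun i => (m i a : ℝ) / N i) U (𝓝 (μ a))) :
    ∃ σ : κ → ℝ, (∀ a, 0 ≤ σ a ∧ σ a ≤ 1) ∧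
      ∀ a, Tendsto (fun i => (k i a : ℝ) / N i) U (𝓝 (μ a * σ a)) := by
  have hfrac : ∀ a, ∃ s ∈ Set.Icc (0 : ℝ) 1, Tendsto (fun i => (k i a : ℝ) / m i a) U (𝓝 s) :=
    fun a => isCompact_Icc.ultrafilter_le_nhds' (U.map fun i => (k i a : ℝ) / m i a) <|
      Ultrafilter.mem_map.2 <| univ_mem' fun i =>
        ⟨by positivity, div_le_one_of_le₀ (Nat.cast_le.2 (hk i a)) (Nat.cast_nonneg _)⟩
  choose σ hσ hlim using hfrac
  refine ⟨σ, hσ, fun a => ((hm a).mul (hlim a)).congr fun i => ?_⟩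
  rcases eq_or_ne (m i a) 0 with h0 | h0
  · simp [Nat.le_zero.1 (h0 ▸ hk i a)]
  · field_simp

/-- Rounding down the prescribed fractions spoils the total weight and the numbers of words. The
number of words of length `r₀` and weight `2` corrects the former, and then the numbers of zero
words correct the latter. -/
lemma exists_evenType_tendsto (hN : Tendsto N F atTop) {s : Finset ℕ} {m : ι → ℕ → ℕ} {μ : ℕ → ℝ}
    {p : ℕ → ℕ → ℝ} {W : ι → ℕ}
    (hm : ∀ r ∈ s, Tendsto (fun i => (m i r : ℝ) / N i) F (𝓝 (μ r)))
    (hμ : ∀ r ∈ s, 0 < μ r) (hp : ∀ r, ∀ a ∈ range (r / 2 + 1), 0 < p r a)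
    (hsum : ∀ r, ∑ a ∈ range (r / 2 + 1), p r a = 1)
    (hW : Tendsto (fun i => (W i : ℝ) / N i) F (𝓝 (∑ r ∈ s, μ r * meanWeight r (p r))))
    (heven : ∀ i, Even (W i)) (hs : ∃ r₀ ∈ s, 2 ≤ r₀) :
    ∃ t : ι → ℕ → ℕ → ℕ,
      (∀ r ∈ s, ∀ a ∈ range (r / 2 + 1),
        Tendsto (fun i => (t i r a : ℝ) / N i) F (𝓝 (μ r * p r a))) ∧
      ∀ᶠ i in F, (∀ r ∈ s, ∑ a ∈ range (r / 2 + 1), t i r a = m i r) ∧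
        ∑ r ∈ s, ∑ a ∈ range (r / 2 + 1), 2 * a * t i r a = W i := by
  obtain ⟨r₀, hr₀, htwo⟩ := hs
  set S : Finset (Σ _ : ℕ, ℕ) := s.sigma fun r => range (r / 2 + 1) with hS
  have hfloor : ∀ c ∈ S, Tendsto (fun i => (⌊(m i c.1 : ℝ) * p c.1 c.2⌋₊ : ℝ) / N i) F
      (𝓝 (μ c.1 * p c.1 c.2)) := fun c hc => by
    obtain ⟨hr, ha⟩ := mem_sigma.1 hc
    refine tendsto_floor_div hN (fun i => mul_nonneg (Nat.cast_nonneg _) (hp _ _ ha).le) ?_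
    exact ((hm _ hr).mul_const _).congr fun i => div_mul_eq_mul_div _ _ _
  have hc₀ : (⟨r₀, 1⟩ : Σ _ : ℕ, ℕ) ∈ S := by
    simp only [hS, mem_sigma, mem_range]
    exact ⟨hr₀, by omega⟩
  obtain ⟨t, -, ht, htotal⟩ := exists_sum_mul_eq_of_tendsto (d := fun c => 2 * c.2) (M := W) hc₀
    (by simp) (fun c _ => by simp) (fun c hc _ => hfloor c hc)
    (mul_pos (hμ _ hr₀) (hp _ _ (mem_sigma.1 hc₀).2)) (fun i => (heven i).two_dvd) (by
      convert hW using 2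
      simp only [hS, sum_sigma, meanWeight, mul_sum]
      exact sum_congr rfl fun r _ => sum_congr rfl fun a _ => by ring)
  have hrows : ∀ r ∈ s, ∃ t' : ι → ℕ → ℕ, (∀ i, ∀ a ≠ 0, t' i a = t i ⟨r, a⟩) ∧
      (∀ a ∈ range (r / 2 + 1), Tendsto (fun i => (t' i a : ℝ) / N i) F (𝓝 (μ r * p r a))) ∧
      ∀ᶠ i in F, ∑ a ∈ range (r / 2 + 1), 1 * t' i a = m i r := fun r hr =>
    exists_sum_mul_eq_of_tendsto (d := fun _ => 1) (x := fun i a => t i ⟨r, a⟩)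
      (ξ := fun a => μ r * p r a) (by simp) one_ne_zero (fun _ _ => dvd_rfl)
      (fun a ha _ => ht ⟨r, a⟩ (mem_sigma.2 ⟨hr, ha⟩)) (mul_pos (hμ r hr) (hp r 0 (by simp)))
      (fun i => one_dvd _) (by simpa [← mul_sum, hsum] using hm r hr)
  choose! t' heq ht' hrow using hrows
  refine ⟨fun i r => t' r i, ht', ?_⟩
  filter_upwards [htotal, (eventually_all_finset s).2 hrow] with i htotal hrow
  refine ⟨fun r hr => by simpa using hrow r hr, ?_⟩
  rw [← htotal, hS, sum_sigma]
  refine sum_congr rfl fun r hr => sum_congr rfl fun a _ => ?_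
  rcases eq_or_ne a 0 with rfl | ha
  · simp
  · rw [heq r hr i a ha]

end Asymptotics

section Coefficients

variable {κ : Type*} (s : Finset κ)

lemma prod_coeff_le_coeff_prod (P : κ → ℕ[X]) (e : κ → ℕ) :
    ∏ i ∈ s, (P i).coeff (e i) ≤ (∏ i ∈ s, P i).coeff (∑ i ∈ s, e i) := by
  classical
  induction s using Finset.induction_on with
  | empty => simp
  | insert a s ha ih =>
    rw [prod_insert ha, prod_insert ha, sum_insert ha, coeff_mul]
    refine (Nat.mul_le_mul_left _ ih).trans ?_
    exact single_le_sum (f := fun x : ℕ × ℕ => (P a).coeff x.1 * (∏ i ∈ s, P i).coeff x.2)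
      (fun _ _ => Nat.zero_le _) (mem_antidiagonal.2 (rfl : (e a, ∑ i ∈ s, e i).1 + _ = _))

lemma prod_monomial_pow (c e t : κ → ℕ) :
    ∏ a ∈ s, (monomial (e a) (c a) : ℕ[X]) ^ t a =
      monomial (∑ a ∈ s, e a * t a) (∏ a ∈ s, c a ^ t a) := by
  simp only [← C_mul_X_pow_eq_monomial, mul_pow, prod_mul_distrib, ← pow_mul,
    prod_pow_eq_pow_sum, map_prod, map_pow]

lemma multinomial_mul_prod_pow_le_coeff (c e t : κ → ℕ) :
    Nat.multinomial s t * ∏ a ∈ s, c a ^ t a ≤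
      ((∑ a ∈ s, (monomial (e a) (c a) : ℕ[X])) ^ ∑ a ∈ s, t a).coeff (∑ a ∈ s, e a * t a) := by
  classical
  set t' : κ → ℕ := fun a => if a ∈ s then t a else 0
  have ht' : ∀ a ∈ s, t' a = t a := fun a ha => if_pos ha
  have hmem : t' ∈ s.piAntidiag (∑ a ∈ s, t a) :=
    mem_piAntidiag.2 ⟨sum_congr rfl ht', fun a ha => by_contra fun h => ha (if_neg h)⟩
  have hterm : ∀ k : κ → ℕ, (Nat.multinomial s k : ℕ[X]) * ∏ a ∈ s, monomial (e a) (c a) ^ k a =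
      monomial (∑ a ∈ s, e a * k a) (Nat.multinomial s k * ∏ a ∈ s, c a ^ k a) := fun k => by
    rw [prod_monomial_pow, ← C_eq_natCast, C_mul_monomial, Nat.cast_id]
  have hcoeff : Nat.multinomial s t * ∏ a ∈ s, c a ^ t a = (monomial (∑ a ∈ s, e a * t' a)
      (Nat.multinomial s t' * ∏ a ∈ s, c a ^ t' a)).coeff (∑ a ∈ s, e a * t a) := by
    have hexp : ∑ a ∈ s, e a * t' a = ∑ a ∈ s, e a * t a :=
      sum_congr rfl fun a ha => by rw [ht' a ha]
    have hprod : ∏ a ∈ s, c a ^ t' a = ∏ a ∈ s, c a ^ t a :=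
      prod_congr rfl fun a ha => by rw [ht' a ha]
    rw [hexp, hprod, coeff_monomial_same, Nat.multinomial_congr ht']
  rw [sum_pow_eq_sum_piAntidiag, finsetSum_coeff, hcoeff]
  simp only [hterm]
  exact single_le_sum (f := fun k : κ → ℕ => (monomial (∑ a ∈ s, e a * k a)
    (Nat.multinomial s k * ∏ a ∈ s, c a ^ k a)).coeff (∑ a ∈ s, e a * t a))
    (fun _ _ => Nat.zero_le _) hmem

lemma coeff_mul_pow_le_eval₂ (P : ℕ[X]) (w : ℕ) {v : ℝ} (hv : 0 ≤ v) :
    (P.coeff w : ℝ) * v ^ w ≤ P.eval₂ (Nat.castRingHom ℝ) v := by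
  have hterm : ∀ m, 0 ≤ (Nat.castRingHom ℝ) (P.coeff m) * v ^ m := fun m =>
    mul_nonneg (Nat.cast_nonneg _) (pow_nonneg hv m)
  rw [eval₂_eq_sum, Polynomial.sum]
  by_cases hw : w ∈ P.support
  · exact single_le_sum (f := fun m => (Nat.castRingHom ℝ) (P.coeff m) * v ^ m)
      (fun m _ => hterm m) hw
  · rw [notMem_support_iff.1 hw, Nat.cast_zero, zero_mul]
    exact sum_nonneg fun m _ => hterm m

end Coefficients

/-! ### The lower bound -/

section EvenTypes

variable {r : ℕ}

/-- The number of tuples of even words of length `r` that contain `t a` words of weight `2 * a`, for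
every `a`. -/
def evenTypeCount (r : ℕ) (t : ℕ → ℕ) : ℕ :=
  Nat.multinomial (range (r / 2 + 1)) t * ∏ a ∈ range (r / 2 + 1), r.choose (2 * a) ^ t a

lemma prod_choose_pow_pos (r : ℕ) (t : ℕ → ℕ) :
    0 < ∏ a ∈ range (r / 2 + 1), r.choose (2 * a) ^ t a :=
  prod_pos fun _ ha => pow_pos (choose_two_mul_pos ha) _

lemma evenTypeCount_pos (r : ℕ) (t : ℕ → ℕ) : 0 < evenTypeCount r t :=
  mul_pos (Nat.multinomial_pos _ _) (prod_choose_pow_pos r t)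

lemma log_evenTypeCount (r : ℕ) (t : ℕ → ℕ) :
    log (evenTypeCount r t) = log (Nat.multinomial (range (r / 2 + 1)) t) +
      ∑ a ∈ range (r / 2 + 1), t a * log (r.choose (2 * a)) := by
  rw [evenTypeCount, Nat.cast_mul, log_mul (mod_cast (Nat.multinomial_pos _ _).ne')
    (mod_cast (prod_choose_pow_pos r t).ne'), Nat.cast_prod, log_prod fun a ha => by
      exact_mod_cast (pow_pos (choose_two_mul_pos ha) _).ne']
  simp only [Nat.cast_pow, log_pow]

lemma evenTypeCount_le_coeff (r : ℕ) (t : ℕ → ℕ) :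
    evenTypeCount r t ≤ (evenPoly r ^ ∑ a ∈ range (r / 2 + 1), t a).coeff
      (∑ a ∈ range (r / 2 + 1), 2 * a * t a) :=
  multinomial_mul_prod_pow_le_coeff _ (fun a => r.choose (2 * a)) (fun a => 2 * a) t

lemma tendsto_log_evenTypeCount {ι : Type*} {F : Filter ι} {N : ι → ℕ} (hN : Tendsto N F atTop)
    {t : ι → ℕ → ℕ} {μ : ℝ} {p : ℕ → ℝ} (hp : ∑ a ∈ range (r / 2 + 1), p a = 1)
    (ht : ∀ a ∈ range (r / 2 + 1), Tendsto (fun i => (t i a : ℝ) / N i) F (𝓝 (μ * p a))) :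
    Tendsto (fun i => log (evenTypeCount r (t i)) / N i) F (𝓝 (μ * evenEntropy r p)) := by
  have hlim : μ * evenEntropy r p = μ * ∑ a ∈ range (r / 2 + 1), negMulLog (p a) +
      ∑ a ∈ range (r / 2 + 1), μ * p a * log (r.choose (2 * a)) := by
    simp only [evenEntropy, sum_add_distrib, mul_add, mul_sum, mul_assoc]
  rw [hlim]
  refine ((tendsto_log_multinomial hN _ hp ht).add (tendsto_finsetSum _ fun a ha =>
    (ht a ha).mul_const (log (r.choose (2 * a))))).congr fun i => ?_
  rw [log_evenTypeCount, add_div, sum_div]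
  simp only [div_mul_eq_mul_div]

end EvenTypes

/-- The number of edges of type `j` at the variable nodes of value one, in words that have `k l`
ones among the variable nodes of degrees `l`. Only the degrees that occur in `D` are counted. -/
def DegreeDist.typeWeight (D : DegreeDist) (k : (Fin 2 → ℕ) → ℕ) (j : Fin 2) : ℕ :=
  ∑ l ∈ D.Λ.support, l j * k l

namespace HasDegreeDist

variable {E : ℕ → Ensemble} {D : DegreeDist} {j : Fin 2}

lemma support_varCount_subset (h : HasDegreeDist E D) (i : ℕ) :
    (E i).varCount.support ⊆ D.Λ.support := fun l hl =>
  Finsupp.mem_support_iff.2 fun hΛ =>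
    Finsupp.mem_support_iff.1 hl (h.varCount_eq_zero i l hΛ)

lemma support_checkCount_subset (h : HasDegreeDist E D) (i : ℕ) (j : Fin 2) :
    ((E i).checkCount j).support ⊆ (D.Γ j).support := fun r hr =>
  Finsupp.mem_support_iff.2 fun hΓ =>
    Finsupp.mem_support_iff.1 hr (h.checkCount_eq_zero i j r hΓ)

@[to_additive]
lemma prod_varCount {M : Type*} [CommMonoid M] (h : HasDegreeDist E D) (i : ℕ)
    (f : (Fin 2 → ℕ) → M) (hf : ∀ l, (E i).varCount l = 0 → f l = 1) :
    ∏ l ∈ (E i).varCount.support, f l = ∏ l ∈ D.Λ.support, f l :=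
  prod_subset (h.support_varCount_subset i) fun l _ hl => hf l (Finsupp.notMem_support_iff.1 hl)

@[to_additive]
lemma prod_checkCount {M : Type*} [CommMonoid M] (h : HasDegreeDist E D) (i : ℕ) (j : Fin 2)
    (f : ℕ → M) (hf : ∀ r, (E i).checkCount j r = 0 → f r = 1) :
    ∏ r ∈ ((E i).checkCount j).support, f r = ∏ r ∈ (D.Γ j).support, f r :=
  prod_subset (h.support_checkCount_subset i j) fun r _ hr =>
    hf r (Finsupp.notMem_support_iff.1 hr)

lemma checkPoly_eq (h : HasDegreeDist E D) (i : ℕ) (j : Fin 2) :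
    (E i).checkPoly j = ∏ r ∈ (D.Γ j).support, evenPoly r ^ (E i).checkCount j r :=
  h.prod_checkCount i j _ fun r hr => by rw [hr, pow_zero]

lemma numEdges_eq_typeWeight (h : HasDegreeDist E D) (i : ℕ) (j : Fin 2) :
    (E i).numEdges j = D.typeWeight (E i).varCount j :=
  h.sum_varCount i (fun l => l j * (E i).varCount l) fun l hl => by rw [hl, mul_zero]

lemma numEdges_eq_sum_checkCount (h : HasDegreeDist E D) (i : ℕ) (j : Fin 2) :
    (E i).numEdges j = ∑ r ∈ (D.Γ j).support, r * (E i).checkCount j r :=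
  ((E i).edges_match j).trans <| h.sum_checkCount i j (fun r => r * (E i).checkCount j r)
    fun r hr => by rw [hr, mul_zero]

lemma tendsto_numEdges (h : HasDegreeDist E D) (j : Fin 2) :
    Tendsto (fun i => ((E i).numEdges j : ℝ) / (E i).blockLength) atTop (𝓝 (D.avgVar j)) := by
  simp only [h.numEdges_eq_typeWeight]
  exact tendsto_natCast_sum_mul_div fun l _ => h.var_tendsto l

lemma tendsto_numChecks (h : HasDegreeDist E D) (hV : 0 < D.avgVar j) (hC : 0 < D.avgCheck j) :
    Tendsto (fun i => ((E i).numChecks j : ℝ) / (E i).blockLength) atTop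
      (𝓝 (D.avgVar j / D.avgCheck j)) := by
  have hdegree : Tendsto (fun i => ((E i).numEdges j : ℝ) / (E i).numChecks j) atTop
      (𝓝 (D.avgCheck j)) := by
    simp only [h.numEdges_eq_sum_checkCount]
    exact tendsto_natCast_sum_mul_div fun r _ => h.check_tendsto j r
  refine ((h.tendsto_numEdges j).div hdegree hC.ne').congr' ?_
  filter_upwards [(h.tendsto_numEdges j).eventually_const_lt hV] with i hi
  have hne : ((E i).numEdges j : ℝ) ≠ 0 := fun h0 => by simp [h0] at hi
  rw [Pi.div_apply, div_div_div_comm, div_self hne, one_div_div]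

lemma tendsto_checkCount (h : HasDegreeDist E D) (hV : 0 < D.avgVar j) (hC : 0 < D.avgCheck j)
    (r : ℕ) :
    Tendsto (fun i => ((E i).checkCount j r : ℝ) / (E i).blockLength) atTop
      (𝓝 (D.avgVar j / D.avgCheck j * D.Γ j r)) := by
  refine ((h.tendsto_numChecks hV hC).mul (h.check_tendsto j r)).congr fun i => ?_
  rcases eq_or_ne ((E i).numChecks j) 0 with h0 | h0
  · have hzero : (E i).checkCount j r = 0 := by_contra fun hr =>
      hr (sum_eq_zero_iff.1 h0 r (Finsupp.mem_support_iff.2 hr))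
    simp [hzero]
  · field_simp

section Types

variable {i : ℕ} {k : (Fin 2 → ℕ) → ℕ}

lemma typeWeight_le (h : HasDegreeDist E D) (hk : ∀ l, k l ≤ (E i).varCount l) (j : Fin 2) :
    D.typeWeight k j ≤ (E i).numEdges j := by
  rw [h.numEdges_eq_typeWeight]
  exact sum_le_sum fun l _ => Nat.mul_le_mul_left _ (hk l)

lemma typeTerm_eq (h : HasDegreeDist E D) (hk : ∀ l, k l ≤ (E i).varCount l) :
    (E i).typeTerm k = (∏ l ∈ D.Λ.support, (((E i).varCount l).choose (k l) : ℝ)) *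
      ∏ j, (((E i).checkPoly j).coeff (D.typeWeight k j) : ℝ) /
        ((E i).numEdges j).choose (D.typeWeight k j) := by
  have hk0 : ∀ l, (E i).varCount l = 0 → k l = 0 := fun l hl => Nat.le_zero.1 (hl ▸ hk l)
  have hweight : ∀ j : Fin 2, ∑ l ∈ (E i).varCount.support, l j * k l = D.typeWeight k j := fun j =>
    h.sum_varCount i (fun l => l j * k l) fun l hl => by rw [hk0 l hl, mul_zero]
  simp only [Ensemble.typeTerm, hweight]
  rw [h.prod_varCount i (fun l => (((E i).varCount l).choose (k l) : ℝ))
    fun l hl => by simp [hk0 l hl]]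

lemma typeTerm_pos_iff (h : HasDegreeDist E D) (hk : ∀ l, k l ≤ (E i).varCount l) :
    0 < (E i).typeTerm k ↔ ∀ j, 0 < ((E i).checkPoly j).coeff (D.typeWeight k j) := by
  rw [((E i).typeTerm_nonneg k).lt_iff_ne', h.typeTerm_eq hk, mul_ne_zero_iff, prod_ne_zero_iff,
    prod_ne_zero_iff, and_iff_right fun l _ => by exact_mod_cast (Nat.choose_pos (hk l)).ne']
  refine ⟨fun hne j => Nat.pos_of_ne_zero fun h0 => hne j (mem_univ j) (by simp [h0]),
    fun hpos j _ => div_ne_zero ?_ ?_⟩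
  · exact_mod_cast (hpos j).ne'
  · exact_mod_cast (Nat.choose_pos (h.typeWeight_le hk j)).ne'

lemma log_typeTerm (h : HasDegreeDist E D) (hk : ∀ l, k l ≤ (E i).varCount l)
    (hpos : ∀ j, 0 < ((E i).checkPoly j).coeff (D.typeWeight k j)) :
    log ((E i).typeTerm k) = ∑ l ∈ D.Λ.support, log (((E i).varCount l).choose (k l)) +
      ∑ j, (log (((E i).checkPoly j).coeff (D.typeWeight k j)) -
        log (((E i).numEdges j).choose (D.typeWeight k j))) := by
  have hvar : ∀ l, (((E i).varCount l).choose (k l) : ℝ) ≠ 0 := fun l =>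
    mod_cast (Nat.choose_pos (hk l)).ne'
  have hedges : ∀ j, (((E i).numEdges j).choose (D.typeWeight k j) : ℝ) ≠ 0 := fun j =>
    mod_cast (Nat.choose_pos (h.typeWeight_le hk j)).ne'
  have hcheck : ∀ j, (((E i).checkPoly j).coeff (D.typeWeight k j) : ℝ) ≠ 0 := fun j =>
    mod_cast (hpos j).ne'
  rw [h.typeTerm_eq hk, log_mul (prod_ne_zero_iff.2 fun l _ => hvar l)
    (prod_ne_zero_iff.2 fun j _ => div_ne_zero (hcheck j) (hedges j)), log_prod fun l _ => hvar l,
    log_prod fun j _ => div_ne_zero (hcheck j) (hedges j)]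
  simp only [log_div (hcheck _) (hedges _)]

end Types

section TypeSequences

variable {F : Filter ℕ} {k : ℕ → (Fin 2 → ℕ) → ℕ} {σ : (Fin 2 → ℕ) → ℝ}

lemma tendsto_typeWeight (hV : 0 < D.avgVar j)
    (hσ : ∀ l, Tendsto (fun i => (k i l : ℝ) / (E i).blockLength) F (𝓝 (D.Λ l * σ l))) :
    Tendsto (fun i => (D.typeWeight (k i) j : ℝ) / (E i).blockLength) F
      (𝓝 (D.avgVar j * D.edgeFrac σ j)) := by
  rw [DegreeDist.edgeFrac, mul_div_cancel₀ _ hV.ne']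
  simp only [mul_assoc]
  exact tendsto_natCast_sum_mul_div fun l _ => hσ l

lemma tendsto_log_typeTerm (h : HasDegreeDist E D) (hV : ∀ j, 0 < D.avgVar j) (hF : F ≤ atTop)
    (hk : ∀ i l, k i l ≤ (E i).varCount l)
    (hσ : ∀ l, Tendsto (fun i => (k i l : ℝ) / (E i).blockLength) F (𝓝 (D.Λ l * σ l)))
    {x : Fin 2 → ℕ → ℝ} {ξ : Fin 2 → ℝ}
    (hx : ∀ j, Tendsto (fun i => x j i / (E i).blockLength) F (𝓝 (ξ j))) :
    Tendsto (fun i => (∑ l ∈ D.Λ.support, log (((E i).varCount l).choose (k i l)) +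
        ∑ j, (x j i - log (((E i).numEdges j).choose (D.typeWeight (k i) j)))) /
          (E i).blockLength) F
      (𝓝 (D.varEntropy σ + ∑ j, (ξ j - D.avgVar j * binEntropy (D.edgeFrac σ j)))) := by
  have hN := h.blockLength_tendsto.mono_left hF
  simp only [add_div, sum_div, sub_div]
  exact (tendsto_finsetSum _ fun l _ => tendsto_log_choose hN ((h.var_tendsto l).mono_left hF)
    (hσ l) fun i => hk i l).add <| tendsto_finsetSum _ fun j _ => (hx j).sub <|
      tendsto_log_choose hN ((h.tendsto_numEdges j).mono_left hF) (tendsto_typeWeight (hV j) hσ)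
        fun i => h.typeWeight_le (hk i) j

end TypeSequences

lemma exists_le_coeff_checkPoly (h : HasDegreeDist E D) (hV : 0 < D.avgVar j)
    (hC : 0 < D.avgCheck j) (hcheck : ∃ r, 2 ≤ r ∧ 0 < D.Γ j r) {p : ℕ → ℕ → ℝ}
    (hp : ∀ r, ∀ a ∈ range (r / 2 + 1), 0 < p r a)
    (hsum : ∀ r, ∑ a ∈ range (r / 2 + 1), p r a = 1) {W : ℕ → ℕ} (heven : ∀ i, Even (W i))
    (hW : Tendsto (fun i => (W i : ℝ) / (E i).blockLength) atTop
      (𝓝 (D.avgVar j / D.avgCheck j * ∑ r ∈ (D.Γ j).support, D.Γ j r * meanWeight r (p r)))) :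
    ∃ c : ℕ → ℕ, (∀ i, 0 < c i) ∧ (∀ᶠ i in atTop, c i ≤ ((E i).checkPoly j).coeff (W i)) ∧
      Tendsto (fun i => log (c i) / (E i).blockLength) atTop (𝓝 (D.checkEntropy j p)) := by
  simp only [mul_sum, ← mul_assoc] at hW
  obtain ⟨r₀, htwo, hΓ⟩ := hcheck
  obtain ⟨t, ht, htype⟩ := exists_evenType_tendsto h.blockLength_tendsto
    (fun r _ => h.tendsto_checkCount hV hC r)
    (fun r hr => mul_pos (div_pos hV hC) (DegreeDist.Γ_pos hr)) hp hsum hW heven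
    ⟨r₀, Finsupp.mem_support_iff.2 hΓ.ne', htwo⟩
  refine ⟨fun i => ∏ r ∈ (D.Γ j).support, evenTypeCount r (t i r),
    fun i => prod_pos fun r _ => evenTypeCount_pos r _, ?_, ?_⟩
  · filter_upwards [htype] with i ⟨hrow, hweight⟩
    rw [h.checkPoly_eq, ← hweight]
    refine (prod_le_prod' fun r hr => ?_).trans (prod_coeff_le_coeff_prod _ _ _)
    rw [← hrow r hr]
    exact evenTypeCount_le_coeff r (t i r)
  · rw [DegreeDist.checkEntropy, mul_sum]
    simp only [← mul_assoc]
    refine (tendsto_finsetSum _ fun r hr => tendsto_log_evenTypeCount h.blockLength_tendsto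
      (hsum r) (ht r hr)).congr fun i => ?_
    rw [← sum_div, Nat.cast_prod,
      log_prod fun r _ => Nat.cast_ne_zero.2 (evenTypeCount_pos r _).ne']

lemma eventually_lt_log_expectedCodewords (h : HasDegreeDist E D) (hV : ∀ j, 0 < D.avgVar j)
    (hC : ∀ j, 0 < D.avgCheck j) (hcheck : ∀ j, ∃ r, 2 ≤ r ∧ 0 < D.Γ j r) {e u v : Fin 2 → ℝ}
    (hs : D.IsSaddlePoint e u v) {x : ℝ} (hx : x < (D.thetaExpr e u v + D.designRate) * log 2) :
    ∀ᶠ i in atTop, x < log (E i).expectedCodewords / (E i).blockLength := by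
  obtain ⟨k, heven, hk, hkσ⟩ := exists_even_le_tendsto_div h.blockLength_tendsto h.var_tendsto
    fun l => ⟨(tilt_pos hs.u_pos l).le, (tilt_lt_one hs.u_pos l).le⟩
  have hweight : ∀ j, Tendsto (fun i => (D.typeWeight (k i) j : ℝ) / (E i).blockLength) atTop
      (𝓝 (D.avgVar j / D.avgCheck j *
        ∑ r ∈ (D.Γ j).support, D.Γ j r * meanWeight r (checkTilt r (v j)))) := fun j => by
    rw [hs.sum_meanWeight_checkTilt (hC j), ← mul_assoc, div_mul_cancel₀ _ (hC j).ne',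
      hs.eq_edgeFrac]
    exact tendsto_typeWeight (hV j) hkσ
  choose c hc_pos hc_le hc_lim using fun j => h.exists_le_coeff_checkPoly (hV j) (hC j) (hcheck j)
    (fun r a ha => checkTilt_pos (hs.v_pos j) ha) (fun r => sum_checkTilt r (hs.v_pos j))
    (fun i => even_sum _ fun l _ => (heven i l).mul_left _) (hweight j)
  have hlim := h.tendsto_log_typeTerm hV le_rfl hk hkσ hc_lim
  have hexponent : D.varEntropy (tilt u) + ∑ j, (D.checkEntropy j (fun r => checkTilt r (v j)) -
      D.avgVar j * binEntropy (D.edgeFrac (tilt u) j)) =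
        (D.thetaExpr e u v + D.designRate) * log 2 := by
    rw [← hs.typeExponent_tilt hV, DegreeDist.typeExponent, ← hs.eq_edgeFrac]
    simp only [DegreeDist.checkPart_eq_checkEntropy (hC _) (hs.sum_meanWeight_checkTilt (hC _))
      (hs.v_pos _)]
  rw [hexponent] at hlim
  filter_upwards [hlim.eventually_const_lt hx, eventually_all.2 hc_le] with i hi hcoeff
  have hcoeff_pos := fun j => (hc_pos j i).trans_le (hcoeff j)
  have hterm := log_le_log ((h.typeTerm_pos_iff (hk i)).2 hcoeff_pos)
    ((E i).typeTerm_le_expectedCodewords (k i))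
  rw [h.log_typeTerm (hk i) hcoeff_pos] at hterm
  refine hi.trans_le (div_le_div_of_nonneg_right (le_trans ?_ hterm) (Nat.cast_nonneg _))
  gcongr with j
  · exact_mod_cast hc_pos j i
  · exact hcoeff j

end HasDegreeDist

/-! ### The upper bound -/

namespace HasDegreeDist

variable {E : ℕ → Ensemble} {D : DegreeDist} {j : Fin 2}

lemma le_of_coeff_checkPoly_pos (h : HasDegreeDist E D) {i w : ℕ}
    (hw : 0 < ((E i).checkPoly j).coeff w) :
    w ≤ ∑ r ∈ (D.Γ j).support, 2 * (r / 2) * (E i).checkCount j r := by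
  refine (le_natDegree_of_ne_zero hw.ne').trans ?_
  rw [h.checkPoly_eq]
  refine (natDegree_prod_le _ _).trans (sum_le_sum fun r _ => ?_)
  rw [mul_comm]
  exact natDegree_pow_le_of_le _ (natDegree_evenPoly_le r)

lemma log_coeff_checkPoly_le (h : HasDegreeDist E D) {i w : ℕ} {v : ℝ} (hv : 0 < v)
    (hw : 0 < ((E i).checkPoly j).coeff w) :
    log (((E i).checkPoly j).coeff w) ≤
      ∑ r ∈ (D.Γ j).support, (E i).checkCount j r * log (q r v) - w * log v := by
  have hcoeff : (0 : ℝ) < ((E i).checkPoly j).coeff w := Nat.cast_pos.2 hw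
  have hle := log_le_log (by positivity) (coeff_mul_pow_le_eval₂ ((E i).checkPoly j) w hv.le)
  rw [log_mul hcoeff.ne' (pow_pos hv w).ne', log_pow, h.checkPoly_eq, eval₂_finsetProd] at hle
  simp only [eval₂_pow, eval₂_evenPoly] at hle
  rw [log_prod fun r _ => (pow_pos (q_pos r hv) _).ne', ← h.checkPoly_eq] at hle
  simp only [log_pow] at hle
  linarith

lemma exists_log_expectedCodewords_le (h : HasDegreeDist E D) (i : ℕ) :
    ∃ k : (Fin 2 → ℕ) → ℕ, (∀ l, k l ≤ (E i).varCount l) ∧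
      (∀ j, 0 < ((E i).checkPoly j).coeff (D.typeWeight k j)) ∧
      log (E i).expectedCodewords ≤
        #D.Λ.support * log ((E i).blockLength + 1) + log ((E i).typeTerm k) := by
  obtain ⟨k, hk, hle⟩ := (E i).exists_expectedCodewords_le
  have hpos : 0 < (E i).typeTerm k :=
    pos_of_mul_pos_right ((E i).expectedCodewords_pos.trans_le hle) (by positivity)
  refine ⟨k, hk, (h.typeTerm_pos_iff hk).1 hpos, ?_⟩
  rw [← log_pow, ← log_mul (by positivity) hpos.ne']
  refine log_le_log (E i).expectedCodewords_pos (hle.trans ?_)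
  gcongr
  · simp
  · exact h.support_varCount_subset i

section Limits

variable {F : Filter ℕ} {k : ℕ → (Fin 2 → ℕ) → ℕ} {σ : (Fin 2 → ℕ) → ℝ}

lemma avgCheck_mul_edgeFrac_le_checkCap [NeBot F] (h : HasDegreeDist E D) (hV : 0 < D.avgVar j)
    (hC : 0 < D.avgCheck j) (hF : F ≤ atTop)
    (hσ : ∀ l, Tendsto (fun i => (k i l : ℝ) / (E i).blockLength) F (𝓝 (D.Λ l * σ l)))
    (hcoeff : ∀ i, 0 < ((E i).checkPoly j).coeff (D.typeWeight (k i) j)) :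
    D.avgCheck j * D.edgeFrac σ j ≤ D.checkCap j := by
  have hcap : Tendsto (fun i => ((∑ r ∈ (D.Γ j).support, 2 * (r / 2) * (E i).checkCount j r : ℕ) :
      ℝ) / (E i).blockLength) F (𝓝 (D.avgVar j / D.avgCheck j * D.checkCap j)) := by
    convert tendsto_natCast_sum_mul_div fun r _ =>
      (h.tendsto_checkCount hV hC r).mono_left hF using 2
    rw [DegreeDist.checkCap, mul_sum]
    exact sum_congr rfl fun r _ => by ring
  have hle := le_of_tendsto_of_tendsto' (tendsto_typeWeight hV hσ) hcap fun i =>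
    div_le_div_of_nonneg_right (Nat.cast_le.2 (h.le_of_coeff_checkPoly_pos (hcoeff i)))
      (Nat.cast_nonneg _)
  rw [div_mul_eq_mul_div, mul_div_assoc] at hle
  exact (le_div_iff₀' hC).1 (le_of_mul_le_mul_left hle hV)

lemma tendsto_checkPart (h : HasDegreeDist E D) (hV : 0 < D.avgVar j) (hC : 0 < D.avgCheck j)
    (hF : F ≤ atTop)
    (hσ : ∀ l, Tendsto (fun i => (k i l : ℝ) / (E i).blockLength) F (𝓝 (D.Λ l * σ l))) (v : ℝ) :
    Tendsto (fun i => (∑ r ∈ (D.Γ j).support, (E i).checkCount j r * log (q r v) -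
        D.typeWeight (k i) j * log v) / (E i).blockLength) F
      (𝓝 (D.checkPart j (D.edgeFrac σ j) v)) := by
  simp only [DegreeDist.checkPart, mul_sum, ← mul_assoc, sub_div, sum_div, mul_div_right_comm]
  exact (tendsto_finsetSum _ fun r _ => ((h.tendsto_checkCount hV hC r).mono_left hF).mul_const
    _).sub ((tendsto_typeWeight hV hσ).mul_const _)

lemma tendsto_log_blockLength_div (h : HasDegreeDist E D) (hF : F ≤ atTop) :
    Tendsto (fun i => log ((E i).blockLength + 1) / (E i).blockLength) F (𝓝 0) := by
  have hN := h.blockLength_tendsto.mono_left hF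
  refine tendsto_log_add_one_div hN (tendsto_const_nhds.congr' (f₁ := fun _ => (1 : ℝ)) ?_)
  filter_upwards [hN.eventually_ne_atTop 0] with i hi
  rw [div_self (Nat.cast_ne_zero.2 hi)]

lemma le_typeExponent [NeBot F] (h : HasDegreeDist E D) (hV : ∀ j, 0 < D.avgVar j)
    (hC : ∀ j, 0 < D.avgCheck j) (hF : F ≤ atTop) (hk : ∀ i l, k i l ≤ (E i).varCount l)
    (hσ : ∀ l, Tendsto (fun i => (k i l : ℝ) / (E i).blockLength) F (𝓝 (D.Λ l * σ l)))
    (hcoeff : ∀ i j, 0 < ((E i).checkPoly j).coeff (D.typeWeight (k i) j)) {x : ℝ}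
    (hx : ∀ᶠ i in F, x ≤ (#D.Λ.support * log ((E i).blockLength + 1) +
      log ((E i).typeTerm (k i))) / (E i).blockLength)
    {v : Fin 2 → ℝ} (hv : ∀ j, 0 < v j) : x ≤ D.typeExponent σ v := by
  have hlim := ((h.tendsto_log_blockLength_div hF).const_mul (#D.Λ.support : ℝ)).add
    (h.tendsto_log_typeTerm hV hF hk hσ fun j => h.tendsto_checkPart (hV j) (hC j) hF hσ (v j))
  rw [mul_zero, zero_add] at hlim
  refine ge_of_tendsto hlim (hx.mono fun i hi => hi.trans ?_)
  rw [← mul_div_assoc, ← add_div, h.log_typeTerm (hk i) (hcoeff i)]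
  gcongr with j
  exact h.log_coeff_checkPoly_le (hv j) (hcoeff i j)

end Limits

lemma eventually_log_expectedCodewords_lt (h : HasDegreeDist E D) (hV : ∀ j, 0 < D.avgVar j)
    (hC : ∀ j, 0 < D.avgCheck j) (hcap : ∀ j, 0 < D.checkCap j) {S : ℝ}
    (hS : S ∈ upperBounds {t | ∃ e ∈ D.region, D.IsTheta e t}) {x : ℝ}
    (hx : (S + D.designRate) * log 2 < x) :
    ∀ᶠ i in atTop, log (E i).expectedCodewords / (E i).blockLength < x := by
  refine mem_iff_ultrafilter.2 fun U hU => by_contra fun hfreq => hx.not_ge ?_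
  have hge : ∀ᶠ i in (U : Filter ℕ), x ≤ log (E i).expectedCodewords / (E i).blockLength :=
    (Ultrafilter.eventually_not.2 hfreq).mono fun i hi => not_lt.1 hi
  choose k hk hcoeff hle using h.exists_log_expectedCodewords_le
  obtain ⟨σ, hσ, hkσ⟩ := exists_tendsto_div_of_le hk fun l => (h.var_tendsto l).mono_left hU
  refine DegreeDist.le_of_forall_le_typeExponent hV hC hcap hS hσ (fun j => ?_) fun v hv => ?_
  · exact h.avgCheck_mul_edgeFrac_le_checkCap (hV j) (hC j) hU hkσ fun i => hcoeff i j
  · refine h.le_typeExponent hV hC hU hk hkσ hcoeff (hge.mono fun i hi => hi.trans ?_) hv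
    exact div_le_div_of_nonneg_right (hle i) (Nat.cast_nonneg _)

lemma tendsto_logb_expectedCodewords (h : HasDegreeDist E D) (hV : ∀ j, 0 < D.avgVar j)
    (hcheck : ∀ j, ∃ r, 2 ≤ r ∧ 0 < D.Γ j r) {S : ℝ}
    (hS : IsLUB {t | ∃ e ∈ D.region, D.IsTheta e t} S) :
    Tendsto (fun i => logb 2 (E i).expectedCodewords / (E i).blockLength) atTop
      (𝓝 (S + D.designRate)) := by
  have hC : ∀ j, 0 < D.avgCheck j := fun j => DegreeDist.avgCheck_pos <|
    (hcheck j).imp fun r hr => ⟨(zero_lt_two.trans_le hr.1).ne', hr.2⟩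
  have hlog : 0 < log 2 := log_pos one_lt_two
  simp only [logb, div_right_comm _ (log 2)]
  refine tendsto_order.2 ⟨fun x hx => ?_, fun x hx => ?_⟩
  · obtain ⟨_, ⟨e, -, u, v, hs, rfl⟩, hlt⟩ := (lt_isLUB_iff hS).1 (sub_lt_iff_lt_add.2 hx)
    exact (h.eventually_lt_log_expectedCodewords hV hC hcheck hs
      (mul_lt_mul_of_pos_right (sub_lt_iff_lt_add.1 hlt) hlog)).mono fun i => (lt_div_iff₀ hlog).2
  · exact (h.eventually_log_expectedCodewords_lt hV hC
      (fun j => DegreeDist.checkCap_pos (hcheck j)) hS.1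
      (mul_lt_mul_of_pos_right hx hlog)).mono fun i => (div_lt_iff₀ hlog).2

end HasDegreeDist

end TwoEdgeLDPC

end

theorem mainTheorem2 (D : TwoEdgeLDPC.DegreeDist)
    (hvar : ∀ j, ∃ l, l j ≠ 0 ∧ 0 < D.Λ l)
    (hcheck : ∀ j, ∃ r, 2 ≤ r ∧ 0 < D.Γ j r) :
    (∀ e t t', D.IsTheta e t → D.IsTheta e t' → t = t') ∧
    ∃ S : ℝ, IsLUB {t | ∃ e ∈ D.region, D.IsTheta e t} S ∧
      ∀ E : ℕ → TwoEdgeLDPC.Ensemble, TwoEdgeLDPC.HasDegreeDist E D →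
        Filter.Tendsto
          (fun k => Real.logb 2 (E k).expectedCodewords / ((E k).blockLength : ℝ))
          Filter.atTop (nhds (S + D.designRate)) := by
  have hV : ∀ j, 0 < D.avgVar j := fun j => TwoEdgeLDPC.DegreeDist.avgVar_pos (hvar j)
  have hC : ∀ j, 0 < D.avgCheck j := fun j => TwoEdgeLDPC.DegreeDist.avgCheck_pos <|
    (hcheck j).imp fun r hr => ⟨(zero_lt_two.trans_le hr.1).ne', hr.2⟩
  have hcap : ∀ j, 0 < D.checkCap j := fun j => TwoEdgeLDPC.DegreeDist.checkCap_pos (hcheck j)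
  obtain ⟨S, hS⟩ := Real.exists_isLUB (TwoEdgeLDPC.DegreeDist.isTheta_nonempty hV hC hcap)
    (TwoEdgeLDPC.DegreeDist.isTheta_bddAbove hV hC)
  exact ⟨fun _ _ _ ht ht' => ht.unique hV hC ht', S, hS,
    fun _ hE => hE.tendsto_logb_expectedCodewords hV hcheck hS⟩
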